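/- **Theorem (Existence of minimizers).** Fix constants $0<a_0\le a_1$ and $a_2,a_3>0$. We say that $a:\mathbb{R}\to\mathbb{R}$ satisfies (A1) if $a\in W^{3,\infty}_{loc}(\mathbb{R})$, $a(0)=0$, $a_0\le a'\le a_1$, $|a''|\le a_2$ and $|a'''|\le a_3$ almost everywhere. For a damping law $a$ consider the system $$\partial_t p+\partial_x u=0,\qquad \partial_t u+\partial_x p+a(u)=0,\qquad x\in(0,1),\ 0<t<T,$$ $$u(0,t)=g_0(t),\quad u(1,t)=g_1(t),\qquad p(x,0)=p_0(x),\quad u(x,0)=u_0(x),$$ whose classical solutions are sought in $C^1([0,T];L^2(0,1)^2)\cap C([0,T];H^1(0,1)^2)$. Assume - (A2) $u_0=0$ and $p_0=c$ for some constant $c\in\mathbb{R}$; - (A3) $T>0$, $g_0,g_1\in C^4([0,T])$, $g_0(0)=g_1(0)=0$ and $g_0'(0)=g_1'(0)=0$. Then there are constants $\underline u<\overline u$ such that $$\underline u\le u(x,t)\le\overline u\qquad\text{for all } x\in[0,1],\ t\in[0,T]$$ and for every classical solution $(p,u)$ of the system with a damping law $a$ satisfying (A1). Fix any such constants, and let $D(F)\subset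 H^2(\underline u,\overline u)$ be the set of restrictions to $(\underline u,\overline u)$ of functions satisfying (A1). For every $a\in D(F)$ the system has exactly one classical solution $(p,u)$ on $[0,T]$ with values of $u$ in $[\underline u,\overline u]$, so that the forward operator $$F:D(F)\to L^2(0,T),\qquad F(a)=p(0,\cdot)-p(1,\cdot),$$ is well defined. Moreover, for every $\alpha>0$, every $h^\delta\in L^2(0,T)$ and every $a^*\in H^2(\underline u,\overline u)$, the Tikhonov functional $$J_\alpha^\delta(a)=\|F(a)-h^\delta\|_{L^2(0,T)}^2+\alpha\,\|a-a^*\|_{H^2(\underline u,\overline u)}^2$$ has a minimizer $a_\alpha^\delta\in D(F)$ over $D(F)$. -/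

import Mathlib

open Set MeasureTheory
open scoped ContDiff

namespace DampedWave

/-- The Lebesgue space `L²(l, r)` of (classes of) real functions on the open interval `(l, r)`. -/
abbrev L2 (l r : ℝ) : Type := Lp ℝ 2 (volume.restrict (Ioo l r))

/-- `g` is a weak derivative of `f` on the open set `s` (used for functions that are locally
integrable on `s`): integration by parts holds against all test functions in `C_c^∞(s)`. -/
def IsWeakDeriv (s : Set ℝ) (f g : ℝ → ℝ) : Prop :=
  ∀ φ : ℝ → ℝ, ContDiff ℝ ∞ φ → HasCompactSupport φ → tsupport φ ⊆ s →
    ∫ x in s, f x * deriv φ x = -∫ x in s, g x * φ x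

/-- A square integrable function times a continuous function of compact support is integrable. -/
theorem integrable_L2_mul {l r : ℝ} (f : L2 l r) {φ : ℝ → ℝ} (hφ : Continuous φ)
    (hc : HasCompactSupport φ) :
    Integrable (fun x => f x * φ x) (volume.restrict (Ioo l r)) := by
  have h2 : MemLp φ 2 (volume.restrict (Ioo l r)) :=
    (hφ.memLp_of_hasCompactSupport hc).restrict _
  exact (Lp.memLp f).integrable_mul h2

theorem integrable_L2_mul_deriv {l r : ℝ} (f : L2 l r) {φ : ℝ → ℝ} (hφ : ContDiff ℝ ∞ φ)
    (hc : HasCompactSupport φ) :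
    Integrable (fun x => f x * deriv φ x) (volume.restrict (Ioo l r)) :=
  integrable_L2_mul f (hφ.continuous_deriv (by simp)) hc.deriv

theorem IsWeakDeriv.L2_zero {l r : ℝ} : IsWeakDeriv (Ioo l r) (0 : L2 l r) (0 : L2 l r) := by
  intro φ _ _ _
  have h0 : (⇑(0 : L2 l r)) =ᵐ[volume.restrict (Ioo l r)] 0 := Lp.coeFn_zero _ _ _
  have h1 : ∀ ψ : ℝ → ℝ, ∫ x in Ioo l r, (0 : L2 l r) x * ψ x = 0 := by
    intro ψ
    rw [integral_congr_ae (g := fun _ => (0 : ℝ))]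
    · simp
    · filter_upwards [h0] with x hx
      rw [hx]; simp
  rw [h1, h1, neg_zero]

theorem IsWeakDeriv.L2_add {l r : ℝ} {f g f' g' : L2 l r}
    (hf : IsWeakDeriv (Ioo l r) f f') (hg : IsWeakDeriv (Ioo l r) g g') :
    IsWeakDeriv (Ioo l r) (f + g : L2 l r) (f' + g' : L2 l r) := by
  intro φ h1 h2 h3
  have key : ∀ (u v : L2 l r) (ψ : ℝ → ℝ),
      Integrable (fun x => u x * ψ x) (volume.restrict (Ioo l r)) →
      Integrable (fun x => v x * ψ x) (volume.restrict (Ioo l r)) →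
      ∫ x in Ioo l r, (u + v : L2 l r) x * ψ x
        = (∫ x in Ioo l r, u x * ψ x) + ∫ x in Ioo l r, v x * ψ x := by
    intro u v ψ hu hv
    rw [← integral_add hu hv]
    apply integral_congr_ae
    filter_upwards [Lp.coeFn_add u v] with x hx
    rw [hx]; simp [add_mul]
  rw [key f g _ (integrable_L2_mul_deriv f h1 h2) (integrable_L2_mul_deriv g h1 h2),
    key f' g' _ (integrable_L2_mul f' h1.continuous h2) (integrable_L2_mul g' h1.continuous h2),
    hf φ h1 h2 h3, hg φ h1 h2 h3]
  ring

theorem IsWeakDeriv.L2_smul {l r : ℝ} (c : ℝ) {f f' : L2 l r}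
    (hf : IsWeakDeriv (Ioo l r) f f') :
    IsWeakDeriv (Ioo l r) (c • f : L2 l r) (c • f' : L2 l r) := by
  intro φ h1 h2 h3
  have key : ∀ (u : L2 l r) (ψ : ℝ → ℝ),
      ∫ x in Ioo l r, (c • u : L2 l r) x * ψ x = c * ∫ x in Ioo l r, u x * ψ x := by
    intro u ψ
    rw [← integral_const_mul]
    apply integral_congr_ae
    filter_upwards [Lp.coeFn_smul c u] with x hx
    rw [hx]; simp [mul_assoc]
  rw [key, key, hf φ h1 h2 h3]
  ring

/-- The Sobolev space `H^k(l, r)`. A function `f` of `H^k` is stored together with its weak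
derivatives as `(f, f', …, f⁽ᵏ⁾)`; the inherited norm is the usual one,
`‖f‖² = ∑_{j ≤ k} ‖f⁽ʲ⁾‖²_{L²(l, r)}`. -/
def Sob (k : ℕ) (l r : ℝ) : Submodule ℝ (PiLp 2 fun _ : Fin (k + 1) => L2 l r) where
  carrier := {v | ∀ j : Fin k, IsWeakDeriv (Ioo l r) (v j.castSucc) (v j.succ)}
  add_mem' hv hw j := (hv j).L2_add (hw j)
  zero_mem' _ := IsWeakDeriv.L2_zero
  smul_mem' c _ hv j := (hv j).L2_smul c

/-- The function underlying an element of `H^k(l, r)`, as an element of `L²(l, r)`. -/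
def fn {k : ℕ} {l r : ℝ} (v : Sob k l r) : L2 l r := v.1 0

/-- The first weak derivative of an element of `H¹(l, r)`. -/
def dx {l r : ℝ} (v : Sob 1 l r) : L2 l r := v.1 1

/-- The continuous representative on the closed interval `[l, r]` of an element of `H^k(l, r)`,
`k ≥ 1`; its values on `[l, r]` are the pointwise values, at `l` and `r` the traces.
Values outside `[l, r]` carry no meaning. -/
noncomputable def rep {k : ℕ} {l r : ℝ} (v : Sob k l r) : ℝ → ℝ :=
  Classical.epsilon fun f : ℝ → ℝ =>
    ContinuousOn f (Icc l r) ∧ fn v =ᵐ[volume.restrict (Ioo l r)] f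

/-- Assumption (A1) on a damping law `a : ℝ → ℝ`: it belongs to `W^{3,∞}_loc(ℝ)` (with `a` its
continuous representative and `d₁`, `d₂`, `d₃` its weak derivatives), `a(0) = 0`,
`a₀ ≤ a' ≤ a₁`, `|a''| ≤ a₂` and `|a'''| ≤ a₃` almost everywhere. -/
def A1 (a₀ a₁ a₂ a₃ : ℝ) (a : ℝ → ℝ) : Prop :=
  Continuous a ∧ a 0 = 0 ∧
  ∃ d₁ d₂ d₃ : ℝ → ℝ,
    LocallyIntegrable d₁ ∧ LocallyIntegrable d₂ ∧ LocallyIntegrable d₃ ∧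
    IsWeakDeriv univ a d₁ ∧ IsWeakDeriv univ d₁ d₂ ∧ IsWeakDeriv univ d₂ d₃ ∧
    (∀ᵐ ξ, a₀ ≤ d₁ ξ ∧ d₁ ξ ≤ a₁) ∧ (∀ᵐ ξ, |d₂ ξ| ≤ a₂) ∧ (∀ᵐ ξ, |d₃ ξ| ≤ a₃)

/-- Assumption (A2) on the initial data on `(0, 1)`: `u₀ = 0` and `p₀` is constant. -/
def A2 (p₀ u₀ : ℝ → ℝ) : Prop :=
  (∀ x ∈ Ioo (0 : ℝ) 1, u₀ x = 0) ∧ ∃ c : ℝ, ∀ x ∈ Ioo (0 : ℝ) 1, p₀ x = c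

/-- Assumption (A3) on the boundary data: `g₀, g₁ ∈ C⁴([0, T])` with `T > 0`, and both functions
vanish at `0` together with their first derivatives. -/
def A3 (T : ℝ) (g₀ g₁ : ℝ → ℝ) : Prop :=
  0 < T ∧ ContDiffOn ℝ 4 g₀ (Icc 0 T) ∧ ContDiffOn ℝ 4 g₁ (Icc 0 T) ∧
  g₀ 0 = 0 ∧ g₁ 0 = 0 ∧ derivWithin g₀ (Icc 0 T) 0 = 0 ∧ derivWithin g₁ (Icc 0 T) 0 = 0

/-- `(p, u)` is a classical solution on `[0, T]` of
`∂ₜp + ∂ₓu = 0`, `∂ₜu + ∂ₓp + a(u) = 0` on `(0, 1)`, `u(0, t) = g₀(t)`, `u(1, t) = g₁(t)`,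
`p(x, 0) = p₀(x)`, `u(x, 0) = u₀(x)`, with
`(p, u) ∈ C¹([0, T]; L² × L²) ∩ C([0, T]; H¹ × H¹)`. Times outside `[0, T]` are irrelevant. -/
structure IsClassicalSolution (T : ℝ) (p₀ u₀ g₀ g₁ : ℝ → ℝ) (a : ℝ → ℝ)
    (p u : ℝ → Sob 1 0 1) : Prop where
  p_cont : ContinuousOn p (Icc 0 T)
  u_cont : ContinuousOn u (Icc 0 T)
  p_contDiff : ContDiffOn ℝ 1 (fun t => fn (p t)) (Icc 0 T)
  u_contDiff : ContDiffOn ℝ 1 (fun t => fn (u t)) (Icc 0 T)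
  mass : ∀ t ∈ Icc 0 T, ∀ᵐ x ∂volume.restrict (Ioo (0 : ℝ) 1),
    derivWithin (fun t => fn (p t)) (Icc 0 T) t x + dx (u t) x = 0
  momentum : ∀ t ∈ Icc 0 T, ∀ᵐ x ∂volume.restrict (Ioo (0 : ℝ) 1),
    derivWithin (fun t => fn (u t)) (Icc 0 T) t x + dx (p t) x + a (fn (u t) x) = 0
  boundary : ∀ t ∈ Icc 0 T, rep (u t) 0 = g₀ t ∧ rep (u t) 1 = g₁ t
  initial : ∀ᵐ x ∂volume.restrict (Ioo (0 : ℝ) 1), fn (p 0) x = p₀ x ∧ fn (u 0) x = u₀ x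

/-- All values `u(x, t)` with `0 ≤ x ≤ 1` and `0 ≤ t ≤ T` lie in `[ul, uh]`. -/
def HasRangeIn (T ul uh : ℝ) (u : ℝ → Sob 1 0 1) : Prop :=
  ∀ t ∈ Icc 0 T, ∀ x ∈ Icc (0 : ℝ) 1, rep (u t) x ∈ Icc ul uh

/-- The constants `ul < uh` bound the flux `u(x, t)`, independently of the damping law: the values
of `u` lie in `[ul, uh]` for every classical solution with a damping law satisfying (A1). -/
def AreFluxBounds (a₀ a₁ a₂ a₃ T : ℝ) (p₀ u₀ g₀ g₁ : ℝ → ℝ) (ul uh : ℝ) : Prop :=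
  ul < uh ∧ ∀ (a : ℝ → ℝ) (p u : ℝ → Sob 1 0 1),
    A1 a₀ a₁ a₂ a₃ a → IsClassicalSolution T p₀ u₀ g₀ g₁ a p u → HasRangeIn T ul uh u

/-- The domain `D(F)` of the forward operator: the elements of `H²(ul, uh)` that are restrictions
to the interval of damping laws satisfying (A1). -/
def domF (a₀ a₁ a₂ a₃ ul uh : ℝ) : Set (Sob 2 ul uh) :=
  {a | ∃ A : ℝ → ℝ, A1 a₀ a₁ a₂ a₃ A ∧ fn a =ᵐ[volume.restrict (Ioo ul uh)] A}

/-- `(p, u)` is the state belonging to a damping law `a` that is given on `[ul, uh]` only: the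
values of `u` lie in `[ul, uh]`, and `(p, u)` solves the system. -/
def IsState (T : ℝ) (p₀ u₀ g₀ g₁ : ℝ → ℝ) {ul uh : ℝ} (a : Sob 2 ul uh)
    (p u : ℝ → Sob 1 0 1) : Prop :=
  HasRangeIn T ul uh u ∧ IsClassicalSolution T p₀ u₀ g₀ g₁ (rep a) p u

/-- `h ∈ L²(0, T)` is the pressure drop `p(0, ·) - p(1, ·)` of a state belonging to `a`. -/
def IsPressureDrop (T : ℝ) (p₀ u₀ g₀ g₁ : ℝ → ℝ) {ul uh : ℝ} (a : Sob 2 ul uh)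
    (h : L2 0 T) : Prop :=
  ∃ p u : ℝ → Sob 1 0 1, IsState T p₀ u₀ g₀ g₁ a p u ∧
    h =ᵐ[volume.restrict (Ioo 0 T)] fun t => rep (p t) 0 - rep (p t) 1

/-- The forward operator `F`, mapping a damping law to its pressure drop in `L²(0, T)`. -/
noncomputable def F (T : ℝ) (p₀ u₀ g₀ g₁ : ℝ → ℝ) {ul uh : ℝ} (a : Sob 2 ul uh) : L2 0 T :=
  Classical.epsilon (IsPressureDrop T p₀ u₀ g₀ g₁ a)

/-- The Tikhonov functional `‖F(a) - h‖²_{L²(0,T)} + α ‖a - a*‖²_{H²(ul,uh)}`. -/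
noncomputable def tikhonov (T : ℝ) (p₀ u₀ g₀ g₁ : ℝ → ℝ) {ul uh : ℝ} (α : ℝ) (h : L2 0 T)
    (aStar : Sob 2 ul uh) (a : Sob 2 ul uh) : ℝ :=
  ‖F T p₀ u₀ g₀ g₁ a - h‖ ^ 2 + α * ‖a - aStar‖ ^ 2

end DampedWave

namespace DampedWave

/-! ### Weak derivatives on intervals -/

theorem exists_Icc_of_tsupport_subset_Ioo {l r : ℝ} (h : l < r) {φ : ℝ → ℝ}
    (hc : HasCompactSupport φ) (hs : tsupport φ ⊆ Ioo l r) :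
    ∃ l' r', l < l' ∧ l' ≤ r' ∧ r' < r ∧ ∀ x, x ∉ Icc l' r' → φ x = 0 := by
  rcases (tsupport φ).eq_empty_or_nonempty with he | hne
  · refine ⟨(l + r) / 2, (l + r) / 2, by linarith, le_rfl, by linarith, fun x _ => ?_⟩
    exact image_eq_zero_of_notMem_tsupport (by simp [he])
  · obtain ⟨a, ha⟩ := hc.isCompact.exists_isLeast hne
    obtain ⟨b, hb⟩ := hc.isCompact.exists_isGreatest hne
    refine ⟨a, b, (hs ha.1).1, ha.2 hb.1, (hs hb.1).2, fun x hx => ?_⟩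
    exact image_eq_zero_of_notMem_tsupport fun hm => hx ⟨ha.2 hm, hb.2 hm⟩

theorem setIntegral_Ioo_eq {l r : ℝ} (h : l ≤ r) (f : ℝ → ℝ) :
    ∫ x in Ioo l r, f x = ∫ x in l..r, f x := by
  rw [intervalIntegral.integral_of_le h, integral_Ioc_eq_integral_Ioo]

theorem exists_testFunction_integral_one {l r : ℝ} (h : l < r) :
    ∃ ψ : ℝ → ℝ, ContDiff ℝ ∞ ψ ∧ HasCompactSupport ψ ∧ tsupport ψ ⊆ Ioo l r ∧
      ∫ x, ψ x = 1 := by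
  let b : ContDiffBump ((l + r) / 2) := ⟨(r - l) / 8, (r - l) / 4, by linarith, by linarith⟩
  refine ⟨b.normed volume, b.contDiff_normed, b.hasCompactSupport_normed, ?_, b.integral_normed⟩
  rw [b.tsupport_normed_eq, Real.closedBall_eq_Icc]
  intro x hx
  simp only [b, mem_Icc, mem_Ioo] at hx ⊢
  constructor <;> linarith [hx.1, hx.2]

/-- A test function with vanishing integral is the derivative of a test function. -/
theorem exists_testFunction_deriv_eq {l r : ℝ} (h : l < r) {φ : ℝ → ℝ} (hφ : ContDiff ℝ ∞ φ)
    (hc : HasCompactSupport φ) (hs : tsupport φ ⊆ Ioo l r) (h0 : ∫ x, φ x = 0) :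
    ∃ Φ : ℝ → ℝ, ContDiff ℝ ∞ Φ ∧ HasCompactSupport Φ ∧ tsupport Φ ⊆ Ioo l r ∧ deriv Φ = φ := by
  obtain ⟨l', r', h1, h2, h3, h4⟩ := exists_Icc_of_tsupport_subset_Ioo h hc hs
  have hd : ∀ x, HasDerivAt (fun y => ∫ t in l'..y, φ t) (φ x) x := fun x =>
    intervalIntegral.integral_hasDerivAt_right (hφ.continuous.intervalIntegrable _ _)
      hφ.continuous.stronglyMeasurable.stronglyMeasurableAtFilter hφ.continuous.continuousAt
  have hder : deriv (fun y => ∫ t in l'..y, φ t) = φ := funext fun x => (hd x).deriv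
  have hr : ∫ t in l'..r', φ t = 0 := by
    rw [intervalIntegral.integral_of_le h2, ← integral_Icc_eq_integral_Ioc,
      setIntegral_eq_integral_of_forall_compl_eq_zero h4, h0]
  have hz : ∀ x, x ∉ Icc l' r' → ∫ t in l'..x, φ t = 0 := by
    have hq : ∀ᵐ t : ℝ, t ≠ l' ∧ t ≠ r' := by
      filter_upwards [compl_mem_ae_iff.2 (measure_singleton l'),
        compl_mem_ae_iff.2 (measure_singleton r')] with t a b
      exact ⟨a, b⟩
    intro x hx
    by_cases hxl : x < l'
    · rw [intervalIntegral.integral_zero_ae]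
      filter_upwards [hq] with t ht ht2
      rw [uIoc_of_ge hxl.le] at ht2
      exact h4 t fun hm => ht.1 (le_antisymm ht2.2 hm.1)
    · have hxr : r' < x := by
        by_contra hh
        exact hx ⟨not_lt.1 hxl, not_lt.1 hh⟩
      rw [← intervalIntegral.integral_add_adjacent_intervals
        (hφ.continuous.intervalIntegrable l' r') (hφ.continuous.intervalIntegrable r' x), hr,
        zero_add, intervalIntegral.integral_zero_ae]
      filter_upwards with t ht2
      rw [uIoc_of_le hxr.le] at ht2
      exact h4 t fun hm => absurd hm.2 (not_le.2 ht2.1)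
  refine ⟨_, contDiff_infty_iff_deriv.2 ⟨fun x => (hd x).differentiableAt, by rw [hder]; exact hφ⟩,
    HasCompactSupport.intro isCompact_Icc hz, ?_, hder⟩
  refine (closure_minimal (fun x hx => ?_) isClosed_Icc).trans
    (show Icc l' r' ⊆ Ioo l r from fun x hx => ⟨h1.trans_le hx.1, hx.2.trans_lt h3⟩)
  by_contra hh
  exact hx (hz x hh)

theorem IntegrableOn.mul_testFunction {s : Set ℝ} {f φ : ℝ → ℝ} (hf : IntegrableOn f s)
    (hφ : Continuous φ) (hc : HasCompactSupport φ) :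
    Integrable (fun x => f x * φ x) (volume.restrict s) := by
  obtain ⟨C, hC⟩ := hφ.bounded_above_of_compact_support hc
  exact Integrable.mul_bdd (c := C) hf hφ.aestronglyMeasurable (.of_forall hC)

theorem setIntegral_testFunction {l r : ℝ} {φ : ℝ → ℝ} (hs : tsupport φ ⊆ Ioo l r) (f : ℝ → ℝ) :
    ∫ x in Ioo l r, f x * φ x = ∫ x, f x * φ x :=
  setIntegral_eq_integral_of_forall_compl_eq_zero fun x hx => by
    rw [image_eq_zero_of_notMem_tsupport fun h => hx (hs h), mul_zero]

theorem tsupport_deriv_subset' {s : Set ℝ} {φ : ℝ → ℝ} (hs : tsupport φ ⊆ s) :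
    tsupport (deriv φ) ⊆ s :=
  (closure_minimal support_deriv_subset isClosed_closure).trans hs

theorem ae_eq_zero_of_testFunction {l r : ℝ} {f : ℝ → ℝ} (hf : IntegrableOn f (Ioo l r))
    (h0 : ∀ φ : ℝ → ℝ, ContDiff ℝ ∞ φ → HasCompactSupport φ → tsupport φ ⊆ Ioo l r →
      ∫ x in Ioo l r, f x * φ x = 0) : f =ᵐ[volume.restrict (Ioo l r)] 0 := by
  rw [Filter.EventuallyEq, ae_restrict_iff' measurableSet_Ioo]
  refine isOpen_Ioo.ae_eq_zero_of_integral_contDiff_smul_eq_zero hf.locallyIntegrableOn ?_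
  intro φ h1 h2 h3
  rw [← h0 φ h1 h2 h3, setIntegral_testFunction h3]
  simp [mul_comm]

/-- The lemma of du Bois-Reymond. -/
theorem IsWeakDeriv.ae_eq_const {l r : ℝ} (h : l < r) {f : ℝ → ℝ} (hf : IntegrableOn f (Ioo l r))
    (h0 : IsWeakDeriv (Ioo l r) f 0) : ∃ c : ℝ, f =ᵐ[volume.restrict (Ioo l r)] fun _ => c := by
  obtain ⟨ψ, p1, p2, p3, p4⟩ := exists_testFunction_integral_one h
  refine ⟨∫ x in Ioo l r, f x * ψ x, ?_⟩
  set c := ∫ x in Ioo l r, f x * ψ x with hcdef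
  have hci : IntegrableOn (fun _ : ℝ => c) (Ioo l r) := by simp
  have key := ae_eq_zero_of_testFunction (hf.sub hci) (f := fun x => f x - c) ?_
  · filter_upwards [key] with x hx
    exact sub_eq_zero.1 hx
  intro φ h1 h2 h3
  set m := ∫ x, φ x with hm
  have ts : tsupport (fun x => φ x - m * ψ x) ⊆ Ioo l r := by
    refine (closure_minimal (t := tsupport φ ∪ tsupport ψ) (fun x hx => ?_)
      (isClosed_closure.union isClosed_closure)).trans (union_subset h3 p3)
    by_contra hh
    rw [mem_union, not_or] at hh
    apply hx
    simp [image_eq_zero_of_notMem_tsupport hh.1, image_eq_zero_of_notMem_tsupport hh.2]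
  obtain ⟨Φ, q1, q2, q3, q4⟩ := exists_testFunction_deriv_eq h
    (φ := fun x => φ x - m * ψ x) (h1.sub (contDiff_const.mul p1))
    (h2.sub (p2.mul_left (f := fun _ => m))) ts (by
      rw [integral_sub (h1.continuous.integrable_of_hasCompactSupport h2)
        ((p1.continuous.integrable_of_hasCompactSupport p2).const_mul m), integral_const_mul, p4]
      simp [hm])
  have e := h0 Φ q1 q2 q3
  rw [q4] at e
  simp only [Pi.zero_apply, zero_mul, integral_zero, neg_zero] at e
  have i1 := IntegrableOn.mul_testFunction hf h1.continuous h2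
  have i2 := IntegrableOn.mul_testFunction hf p1.continuous p2
  have i3 := IntegrableOn.mul_testFunction hci h1.continuous h2
  have e2 : ∫ x in Ioo l r, f x * φ x = m * c := by
    rw [hcdef, ← integral_const_mul, ← sub_eq_zero, ← integral_sub i1 (i2.const_mul m), ← e]
    refine integral_congr_ae (.of_forall fun x => ?_)
    simp only; ring
  have e3 : ∫ x in Ioo l r, c * φ x = c * m := by
    rw [setIntegral_testFunction h3, integral_const_mul]
  simp only [sub_mul]
  rw [integral_sub i1 i3, e2, e3]; ring

theorem IsWeakDeriv.sub {l r : ℝ} {f g f' g' : ℝ → ℝ}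
    (if1 : IntegrableOn f (Ioo l r)) (ig1 : IntegrableOn g (Ioo l r))
    (if2 : IntegrableOn f' (Ioo l r)) (ig2 : IntegrableOn g' (Ioo l r))
    (hf : IsWeakDeriv (Ioo l r) f f') (hg : IsWeakDeriv (Ioo l r) g g') :
    IsWeakDeriv (Ioo l r) (f - g) (f' - g') := by
  intro φ h1 h2 h3
  have c1 := h1.continuous
  have c2 : Continuous (deriv φ) := h1.continuous_deriv (by simp)
  simp only [Pi.sub_apply, sub_mul]
  rw [integral_sub (IntegrableOn.mul_testFunction if1 c2 h2.deriv)
      (IntegrableOn.mul_testFunction ig1 c2 h2.deriv),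
    integral_sub (IntegrableOn.mul_testFunction if2 c1 h2)
      (IntegrableOn.mul_testFunction ig2 c1 h2), hf φ h1 h2 h3, hg φ h1 h2 h3]
  ring

theorem IsWeakDeriv.congr_ae {s : Set ℝ} {f g f' g' : ℝ → ℝ} (h : IsWeakDeriv s f f')
    (e : f =ᵐ[volume.restrict s] g) (e' : f' =ᵐ[volume.restrict s] g') : IsWeakDeriv s g g' := by
  intro φ h1 h2 h3
  rw [integral_congr_ae (g := fun x => f x * deriv φ x), h φ h1 h2 h3,
    integral_congr_ae (f := fun x => g' x * φ x) (g := fun x => f' x * φ x)]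
  · filter_upwards [e'] with x hx
    rw [hx]
  · filter_upwards [e] with x hx
    rw [hx]

theorem IsWeakDeriv.ae_unique {l r : ℝ} {f g g' : ℝ → ℝ}
    (hg : IntegrableOn g (Ioo l r)) (hg' : IntegrableOn g' (Ioo l r))
    (h : IsWeakDeriv (Ioo l r) f g) (h' : IsWeakDeriv (Ioo l r) f g') :
    g =ᵐ[volume.restrict (Ioo l r)] g' := by
  have key := ae_eq_zero_of_testFunction (hg.sub hg') ?_
  · filter_upwards [key] with x hx
    exact sub_eq_zero.1 hx
  intro φ h1 h2 h3
  simp only [Pi.sub_apply, sub_mul]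
  rw [integral_sub (IntegrableOn.mul_testFunction hg h1.continuous h2)
      (IntegrableOn.mul_testFunction hg' h1.continuous h2)]
  linarith [h φ h1 h2 h3, h' φ h1 h2 h3]

/-- An absolutely continuous function is weakly differentiable. -/
theorem AbsolutelyContinuousOnInterval.isWeakDeriv {l r : ℝ} (h : l < r) {f g : ℝ → ℝ}
    (hf : AbsolutelyContinuousOnInterval f l r)
    (hg : ∀ᵐ x ∂volume.restrict (Ioo l r), deriv f x = g x) : IsWeakDeriv (Ioo l r) f g := by
  intro φ h1 h2 h3
  obtain ⟨l', r', a1, a2, a3, a4⟩ := exists_Icc_of_tsupport_subset_Ioo h h2 h3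
  have hφ : AbsolutelyContinuousOnInterval φ l r :=
    ((h1.of_le (by simp)).contDiffOn).absolutelyContinuousOnInterval
  have e := hf.integral_mul_deriv_eq_deriv_mul hφ
  rw [a4 l fun hm => absurd hm.1 (not_le.2 a1), a4 r fun hm => absurd hm.2 (not_le.2 a3)] at e
  rw [setIntegral_Ioo_eq h.le, e, ← setIntegral_Ioo_eq h.le, mul_zero, mul_zero, sub_zero, zero_sub,
    integral_congr_ae (g := fun x => g x * φ x)]
  filter_upwards [hg] with x hx
  rw [hx]

theorem IntegrableOn.intervalIntegrable_Ioo {l r : ℝ} (h : l ≤ r) {g : ℝ → ℝ}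
    (hg : IntegrableOn g (Ioo l r)) : IntervalIntegrable g volume l r :=
  (intervalIntegrable_iff_integrableOn_Ioo_of_le h).2 hg

theorem absolutelyContinuous_const_add_integral {l r : ℝ} (h : l ≤ r) (c : ℝ) {g : ℝ → ℝ}
    (hg : IntegrableOn g (Ioo l r)) :
    AbsolutelyContinuousOnInterval (fun x => c + ∫ t in l..x, g t) l r := by
  have h1 := (IntegrableOn.intervalIntegrable_Ioo h hg).absolutelyContinuousOnInterval_intervalIntegral
    (c := l) left_mem_uIcc
  have h2 : AbsolutelyContinuousOnInterval (fun _ : ℝ => c) l r :=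
    (contDiffOn_const (n := 1)).absolutelyContinuousOnInterval
  exact h2.add h1

theorem ae_deriv_const_add_integral {l r : ℝ} (h : l ≤ r) (c : ℝ) {g : ℝ → ℝ}
    (hg : IntegrableOn g (Ioo l r)) :
    ∀ᵐ x ∂volume.restrict (Ioo l r), deriv (fun x => c + ∫ t in l..x, g t) x = g x := by
  rw [ae_restrict_iff' measurableSet_Ioo]
  filter_upwards [(IntegrableOn.intervalIntegrable_Ioo h hg).ae_hasDerivAt_integral] with x hx hm
  have := hx (by rw [uIcc_of_le h]; exact ⟨hm.1.le, hm.2.le⟩) l left_mem_uIcc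
  exact (this.const_add c).deriv

theorem isWeakDeriv_const_add_integral {l r : ℝ} (h : l < r) (c : ℝ) {g : ℝ → ℝ}
    (hg : IntegrableOn g (Ioo l r)) :
    IsWeakDeriv (Ioo l r) (fun x => c + ∫ t in l..x, g t) g :=
  AbsolutelyContinuousOnInterval.isWeakDeriv h (absolutelyContinuous_const_add_integral h.le c hg)
    (ae_deriv_const_add_integral h.le c hg)

/-- A weakly differentiable function is the integral of its weak derivative. -/
theorem IsWeakDeriv.ae_eq_const_add_integral {l r : ℝ} (h : l < r) {f g : ℝ → ℝ}
    (hf : IntegrableOn f (Ioo l r)) (hg : IntegrableOn g (Ioo l r))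
    (hw : IsWeakDeriv (Ioo l r) f g) :
    ∃ c : ℝ, f =ᵐ[volume.restrict (Ioo l r)] fun x => c + ∫ t in l..x, g t := by
  have hi : IntegrableOn (fun x => 0 + ∫ t in l..x, g t) (Ioo l r) := by
    have := (absolutelyContinuous_const_add_integral h.le 0 hg).continuousOn
    rw [uIcc_of_le h.le] at this
    exact (this.integrableOn_compact isCompact_Icc).mono_set Ioo_subset_Icc_self
  have hw2 := hw.sub hf hi hg hg (isWeakDeriv_const_add_integral h 0 hg)
  rw [sub_self] at hw2
  obtain ⟨c, hc⟩ := hw2.ae_eq_const h (hf.sub hi)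
  refine ⟨c, ?_⟩
  filter_upwards [hc] with x hx
  simp only [Pi.sub_apply] at hx
  linarith

/-! ### The spaces `H^k(l, r)` -/

theorem L2.integrableOn {l r : ℝ} (f : L2 l r) : IntegrableOn f (Ioo l r) :=
  (Lp.memLp f).integrable (by norm_num)

theorem Icc_eqOn_of_ae_eq {l r : ℝ} (h : l < r) {f g : ℝ → ℝ}
    (e : f =ᵐ[volume.restrict (Ioo l r)] g) (hf : ContinuousOn f (Icc l r))
    (hg : ContinuousOn g (Icc l r)) : EqOn f g (Icc l r) := by
  exact Measure.eqOn_Icc_of_ae_eq volume h.ne (by rwa [← restrict_Ioo_eq_restrict_Icc]) hf hg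

theorem rep_spec {k : ℕ} {l r : ℝ} {v : Sob k l r} {f : ℝ → ℝ}
    (hf : ContinuousOn f (Icc l r)) (e : fn v =ᵐ[volume.restrict (Ioo l r)] f) :
    ContinuousOn (rep v) (Icc l r) ∧ fn v =ᵐ[volume.restrict (Ioo l r)] rep v :=
  Classical.epsilon_spec (p := fun f : ℝ → ℝ =>
    ContinuousOn f (Icc l r) ∧ fn v =ᵐ[volume.restrict (Ioo l r)] f) ⟨f, hf, e⟩

theorem rep_eqOn {k : ℕ} {l r : ℝ} (h : l < r) {v : Sob k l r} {f : ℝ → ℝ}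
    (hf : ContinuousOn f (Icc l r)) (e : fn v =ᵐ[volume.restrict (Ioo l r)] f) :
    EqOn (rep v) f (Icc l r) :=
  Icc_eqOn_of_ae_eq h ((rep_spec hf e).2.symm.trans e) (rep_spec hf e).1 hf

theorem Sob.isWeakDeriv_dx {l r : ℝ} (v : Sob 1 l r) : IsWeakDeriv (Ioo l r) (fn v) (dx v) :=
  v.2 0

theorem Sob.exists_rep_eq {l r : ℝ} (h : l < r) (v : Sob 1 l r) :
    ∃ c : ℝ, EqOn (rep v) (fun x => c + ∫ t in l..x, dx v t) (Icc l r) ∧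
      fn v =ᵐ[volume.restrict (Ioo l r)] fun x => c + ∫ t in l..x, dx v t := by
  obtain ⟨c, hc⟩ := (Sob.isWeakDeriv_dx v).ae_eq_const_add_integral h (L2.integrableOn _)
    (L2.integrableOn _)
  have hcont := (absolutelyContinuous_const_add_integral h.le c (L2.integrableOn (dx v))).continuousOn
  rw [uIcc_of_le h.le] at hcont
  exact ⟨c, rep_eqOn h hcont hc, hc⟩

theorem Sob.fn_ae_eq_rep {l r : ℝ} (h : l < r) (v : Sob 1 l r) :
    fn v =ᵐ[volume.restrict (Ioo l r)] rep v := by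
  obtain ⟨c, h1, h2⟩ := Sob.exists_rep_eq h v
  filter_upwards [h2, ae_restrict_mem measurableSet_Ioo] with x hx hm
  rw [hx, h1 (Ioo_subset_Icc_self hm)]

theorem Sob.rep_sub {l r : ℝ} (h : l < r) (v w : Sob 1 l r) :
    EqOn (rep (v - w)) (fun x => rep v x - rep w x) (Icc l r) := by
  have hcont : ∀ v : Sob 1 l r, ContinuousOn (rep v) (Icc l r) := fun v => by
    obtain ⟨c, h1, h2⟩ := Sob.exists_rep_eq h v
    have hc := (absolutelyContinuous_const_add_integral h.le c
      (L2.integrableOn (dx v))).continuousOn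
    rw [uIcc_of_le h.le] at hc
    exact hc.congr h1
  refine rep_eqOn h ((hcont v).sub (hcont w)) ?_
  have e : fn (v - w) = fn v - fn w := rfl
  rw [e]
  filter_upwards [Lp.coeFn_sub (fn v) (fn w), Sob.fn_ae_eq_rep h v, Sob.fn_ae_eq_rep h w] with x h1 h2 h3
  rw [h1, Pi.sub_apply, h2, h3]

/-- An element of `H¹` is determined by its underlying function. -/
theorem Sob.ext_fn {l r : ℝ} {v w : Sob 1 l r} (h : fn v = fn w) : v = w := by
  have hd : dx v = dx w := by
    apply Lp.ext
    refine IsWeakDeriv.ae_unique (L2.integrableOn _) (L2.integrableOn _) (Sob.isWeakDeriv_dx v) ?_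
    rw [h]
    exact (Sob.isWeakDeriv_dx w)
  apply Subtype.ext
  apply PiLp.ext
  intro i
  fin_cases i
  · exact h
  · exact hd

/-- Integration by parts in `H¹`, if one of the functions has vanishing traces. -/
theorem Sob.inner_add_inner_eq_zero {l r : ℝ} (h : l < r) (q w : Sob 1 l r)
    (hl : rep w l = 0) (hr : rep w r = 0) :
    inner ℝ (fn q) (dx w) + inner ℝ (fn w) (dx q) = 0 := by
  obtain ⟨c, c1, c2⟩ := Sob.exists_rep_eq h q
  obtain ⟨d, d1, d2⟩ := Sob.exists_rep_eq h w
  have a1 := absolutelyContinuous_const_add_integral h.le c (L2.integrableOn (dx q))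
  have b1 := absolutelyContinuous_const_add_integral h.le d (L2.integrableOn (dx w))
  have a2 := ae_deriv_const_add_integral h.le c (L2.integrableOn (dx q))
  have b2 := ae_deriv_const_add_integral h.le d (L2.integrableOn (dx w))
  have e := a1.integral_deriv_mul_eq_sub b1
  have el := d1 (left_mem_Icc.2 h.le)
  have er := d1 (right_mem_Icc.2 h.le)
  rw [hl] at el
  rw [hr] at er
  simp only at el er
  rw [← el, ← er, mul_zero, mul_zero, sub_zero, ← setIntegral_Ioo_eq h.le] at e
  rw [L2.inner_def, L2.inner_def, ← integral_add, ← e]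
  · refine integral_congr_ae ?_
    filter_upwards [a2, b2, c2, d2] with x h1 h2 h3 h4
    rw [h1, h2, ← h3, ← h4]
    simp only [RCLike.inner_apply, conj_trivial]
    ring
  · exact L2.integrable_inner _ _
  · exact L2.integrable_inner _ _

theorem memLp_IccExtend {l r : ℝ} (h : l ≤ r) (f : C(Icc l r, ℝ)) :
    MemLp (IccExtend h f) 2 (volume.restrict (Ioo l r)) :=
  MemLp.of_bound f.continuous.Icc_extend'.aestronglyMeasurable ‖f‖
    (.of_forall fun x => f.norm_coe_le_norm (projIcc l r h x))

/-- The class in `L²(l, r)` of a continuous function on `[l, r]`. -/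
noncomputable def ofCont {l r : ℝ} (h : l ≤ r) : C(Icc l r, ℝ) →L[ℝ] L2 l r :=
  LinearMap.mkContinuous
    { toFun := fun f => (memLp_IccExtend h f).toLp
      map_add' := fun f g => by
        rw [← MemLp.toLp_add]
        rfl
      map_smul' := fun c f => by
        rw [RingHom.id_apply, ← MemLp.toLp_const_smul]
        rfl }
    (measureUnivNNReal (volume.restrict (Ioo l r)) ^ (2 : ENNReal).toReal⁻¹) (by
      intro f
      refine Lp.norm_le_of_ae_bound (norm_nonneg f) ?_
      filter_upwards [MemLp.coeFn_toLp (memLp_IccExtend h f)] with x hx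
      refine (congrArg norm hx).trans_le ?_
      exact f.norm_coe_le_norm (projIcc l r h x))

theorem ofCont_ae_eq {l r : ℝ} (h : l ≤ r) (f : C(Icc l r, ℝ)) :
    ofCont h f =ᵐ[volume.restrict (Ioo l r)] IccExtend h f :=
  MemLp.coeFn_toLp (memLp_IccExtend h f)

/-- The restriction to `[l, r]` of a continuous function. -/
def restr (l r : ℝ) (f : ℝ → ℝ) (hf : ContinuousOn f (Icc l r)) : C(Icc l r, ℝ) :=
  ⟨(Icc l r).domRestrict f, hf.domRestrict⟩

theorem ofCont_restr_ae_eq {l r : ℝ} (h : l ≤ r) {f : ℝ → ℝ} (hf : ContinuousOn f (Icc l r)) :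
    ofCont h (restr l r f hf) =ᵐ[volume.restrict (Ioo l r)] f := by
  filter_upwards [ofCont_ae_eq h (restr l r f hf), ae_restrict_mem measurableSet_Ioo] with x hx hm
  rw [hx, IccExtend_of_mem _ _ (Ioo_subset_Icc_self hm)]
  rfl

theorem isWeakDeriv_of_hasDerivAt {l r : ℝ} (h : l < r) {f f' : ℝ → ℝ}
    (hf : ContinuousOn f (Icc l r)) (hf' : ContinuousOn f' (Icc l r))
    (hd : ∀ x ∈ Ioo l r, HasDerivAt f (f' x) x) : IsWeakDeriv (Ioo l r) f f' := by
  have hi : IntegrableOn f' (Ioo l r) :=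
    (hf'.integrableOn_compact isCompact_Icc).mono_set Ioo_subset_Icc_self
  refine (isWeakDeriv_const_add_integral h (f l) hi).congr_ae ?_ .rfl
  filter_upwards [ae_restrict_mem measurableSet_Ioo] with x hx
  rw [intervalIntegral.integral_eq_sub_of_hasDerivAt_of_le hx.1.le
    (hf.mono (Icc_subset_Icc_right hx.2.le)) (fun y hy => hd y ⟨hy.1, hy.2.trans hx.2⟩)]
  · ring
  · exact (hf'.mono (by rw [uIcc_of_le hx.1.le]; exact Icc_subset_Icc_right hx.2.le)).intervalIntegrable

/-- The element of `H¹(l, r)` given by a continuously differentiable function. -/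
noncomputable def mkSob1 {l r : ℝ} (h : l < r) (f f' : C(Icc l r, ℝ))
    (hd : ∀ x ∈ Ioo l r, HasDerivAt (IccExtend h.le f) (IccExtend h.le f' x) x) : Sob 1 l r :=
  ⟨WithLp.toLp 2 ![ofCont h.le f, ofCont h.le f'], by
    intro j
    fin_cases j
    exact (isWeakDeriv_of_hasDerivAt h f.continuous.Icc_extend'.continuousOn
      f'.continuous.Icc_extend'.continuousOn hd).congr_ae (ofCont_ae_eq _ _).symm
        (ofCont_ae_eq _ _).symm⟩

/-- The element of `H²(l, r)` given by a twice continuously differentiable function. -/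
noncomputable def mkSob2 {l r : ℝ} (h : l < r) (f f' f'' : C(Icc l r, ℝ))
    (hd : ∀ x ∈ Ioo l r, HasDerivAt (IccExtend h.le f) (IccExtend h.le f' x) x)
    (hd' : ∀ x ∈ Ioo l r, HasDerivAt (IccExtend h.le f') (IccExtend h.le f'' x) x) : Sob 2 l r :=
  ⟨WithLp.toLp 2 ![ofCont h.le f, ofCont h.le f', ofCont h.le f''], by
    intro j
    fin_cases j
    · exact (isWeakDeriv_of_hasDerivAt h f.continuous.Icc_extend'.continuousOn
        f'.continuous.Icc_extend'.continuousOn hd).congr_ae (ofCont_ae_eq _ _).symm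
          (ofCont_ae_eq _ _).symm
    · exact (isWeakDeriv_of_hasDerivAt h f'.continuous.Icc_extend'.continuousOn
        f''.continuous.Icc_extend'.continuousOn hd').congr_ae (ofCont_ae_eq _ _).symm
          (ofCont_ae_eq _ _).symm⟩

theorem rep_mkSob1 {l r : ℝ} (h : l < r) (f f' : C(Icc l r, ℝ))
    (hd : ∀ x ∈ Ioo l r, HasDerivAt (IccExtend h.le f) (IccExtend h.le f' x) x) :
    EqOn (rep (mkSob1 h f f' hd)) (IccExtend h.le f) (Icc l r) :=
  rep_eqOn h f.continuous.Icc_extend'.continuousOn (ofCont_ae_eq _ _)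

theorem Sob.continuousOn_of_fn_dx {X : Type*} [TopologicalSpace X] {s : Set X} {l r : ℝ}
    (v : X → Sob 1 l r) (h1 : ContinuousOn (fun t => fn (v t)) s)
    (h2 : ContinuousOn (fun t => dx (v t)) s) : ContinuousOn v s := by
  rw [Topology.IsInducing.subtypeVal.continuousOn_iff]
  have : (fun t => (v t).1) = fun t => WithLp.toLp 2 ![fn (v t), dx (v t)] := by
    funext t
    apply PiLp.ext
    intro i
    fin_cases i <;> rfl
  change ContinuousOn (fun t => (v t).1) s
  rw [this]
  refine (PiLp.continuous_toLp 2 _).comp_continuousOn ?_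
  rw [continuousOn_pi]
  intro i
  fin_cases i
  · exact h1
  · exact h2

/-! ### Uniqueness of classical solutions -/


theorem inner_nonpos_of_monotone {l r : ℝ} {A : ℝ → ℝ} (hA : Monotone A) (u₁ u₂ z : L2 l r)
    (hz : ∀ᵐ x ∂volume.restrict (Ioo l r), z x = -(A (u₁ x) - A (u₂ x))) :
    inner ℝ (u₁ - u₂) z ≤ 0 := by
  rw [L2.inner_def]
  refine integral_nonpos_of_ae ?_
  filter_upwards [hz, Lp.coeFn_sub u₁ u₂] with x h1 h2
  rw [h1, h2]
  simp only [Pi.sub_apply, RCLike.inner_apply, conj_trivial, Pi.zero_apply]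
  rcases le_total (u₁ x) (u₂ x) with h | h
  · nlinarith [mul_nonneg (sub_nonneg.2 h) (sub_nonneg.2 (hA h))]
  · nlinarith [mul_nonneg (sub_nonneg.2 h) (sub_nonneg.2 (hA h))]

theorem IsClassicalSolution.eqOn {T : ℝ} {p₀ u₀ g₀ g₁ A : ℝ → ℝ} (hA : Monotone A)
    {p₁ u₁ p₂ u₂ : ℝ → Sob 1 0 1} (h₁ : IsClassicalSolution T p₀ u₀ g₀ g₁ A p₁ u₁)
    (h₂ : IsClassicalSolution T p₀ u₀ g₀ g₁ A p₂ u₂) :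
    EqOn p₁ p₂ (Icc 0 T) ∧ EqOn u₁ u₂ (Icc 0 T) := by
  rcases lt_or_ge T 0 with hT | hT
  · simp [Icc_eq_empty (not_le.2 hT)]
  set E : ℝ → ℝ := fun t => ‖fn (p₁ t) - fn (p₂ t)‖ ^ 2 + ‖fn (u₁ t) - fn (u₂ t)‖ ^ 2 with hE
  have hdiff : ∀ {f : ℝ → L2 0 1}, ContDiffOn ℝ 1 f (Icc 0 T) → ∀ t ∈ Ioo 0 T,
      HasDerivAt f (derivWithin f (Icc 0 T) t) t := fun {f} hf t ht =>
    ((hf.differentiableOn one_ne_zero t (Ioo_subset_Icc_self ht)).hasDerivWithinAt).hasDerivAt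
      (Icc_mem_nhds ht.1 ht.2)
  have hEd : ∀ t ∈ Ioo 0 T, ∃ d ≤ 0, HasDerivAt E d t := by
    intro t ht
    have ht' := Ioo_subset_Icc_self ht
    have d1 := (hdiff h₁.p_contDiff t ht).sub (hdiff h₂.p_contDiff t ht)
    have d2 := (hdiff h₁.u_contDiff t ht).sub (hdiff h₂.u_contDiff t ht)
    refine ⟨_, ?_, d1.norm_sq.add d2.norm_sq⟩
    set P := derivWithin (fun t => fn (p₁ t)) (Icc 0 T) t -
      derivWithin (fun t => fn (p₂ t)) (Icc 0 T) t with hP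
    set U := derivWithin (fun t => fn (u₁ t)) (Icc 0 T) t -
      derivWithin (fun t => fn (u₂ t)) (Icc 0 T) t with hU
    have eP : P = -dx (u₁ t - u₂ t) := by
      have e : dx (u₁ t - u₂ t) = dx (u₁ t) - dx (u₂ t) := rfl
      rw [e]
      apply Lp.ext
      filter_upwards [h₁.mass t ht', h₂.mass t ht', Lp.coeFn_sub
        (derivWithin (fun t => fn (p₁ t)) (Icc 0 T) t) (derivWithin (fun t => fn (p₂ t)) (Icc 0 T) t),
        Lp.coeFn_neg (dx (u₁ t) - dx (u₂ t)), Lp.coeFn_sub (dx (u₁ t)) (dx (u₂ t))]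
        with x a b c d e
      rw [hP, c, d, Pi.neg_apply, e, Pi.sub_apply, Pi.sub_apply]
      linarith
    have eU : inner ℝ (fn (u₁ t) - fn (u₂ t)) (U + dx (p₁ t - p₂ t)) ≤ 0 := by
      refine inner_nonpos_of_monotone hA _ _ _ ?_
      have e : dx (p₁ t - p₂ t) = dx (p₁ t) - dx (p₂ t) := rfl
      rw [e]
      filter_upwards [h₁.momentum t ht', h₂.momentum t ht', Lp.coeFn_sub
        (derivWithin (fun t => fn (u₁ t)) (Icc 0 T) t) (derivWithin (fun t => fn (u₂ t)) (Icc 0 T) t),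
        Lp.coeFn_add U (dx (p₁ t) - dx (p₂ t)), Lp.coeFn_sub (dx (p₁ t)) (dx (p₂ t))]
        with x a b c d e
      rw [d, Pi.add_apply, hU, c, e, Pi.sub_apply, Pi.sub_apply]
      linarith
    have tr : ∀ x ∈ Icc (0 : ℝ) 1, rep (u₁ t) x = rep (u₂ t) x → rep (u₁ t - u₂ t) x = 0 :=
      fun x hx e => by rw [Sob.rep_sub one_pos _ _ hx]; simp [e]
    have ibp := Sob.inner_add_inner_eq_zero one_pos (p₁ t - p₂ t) (u₁ t - u₂ t)
      (tr 0 (by simp) ((h₁.boundary t ht').1.trans (h₂.boundary t ht').1.symm))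
      (tr 1 (by simp) ((h₁.boundary t ht').2.trans (h₂.boundary t ht').2.symm))
    change inner ℝ (fn (p₁ t) - fn (p₂ t)) _ + inner ℝ (fn (u₁ t) - fn (u₂ t)) _ = 0 at ibp
    rw [inner_add_right] at eU
    simp only [Pi.sub_apply]
    rw [eP, inner_neg_right]
    linarith
  have hcont : ContinuousOn E (Icc 0 T) :=
    ((h₁.p_contDiff.continuousOn.sub h₂.p_contDiff.continuousOn).norm.pow 2).add
      ((h₁.u_contDiff.continuousOn.sub h₂.u_contDiff.continuousOn).norm.pow 2)
  have hanti : AntitoneOn E (Icc 0 T) := by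
    refine antitoneOn_of_deriv_nonpos (convex_Icc _ _) hcont ?_ ?_
    · rw [interior_Icc]
      intro t ht
      obtain ⟨d, _, hd⟩ := hEd t ht
      exact hd.differentiableAt.differentiableWithinAt
    · rw [interior_Icc]
      intro t ht
      obtain ⟨d, h0, hd⟩ := hEd t ht
      rwa [hd.deriv]
  have h0 : E 0 = 0 := by
    have a : fn (p₁ 0) = fn (p₂ 0) := by
      apply Lp.ext
      filter_upwards [h₁.initial, h₂.initial] with x h1 h2
      rw [h1.1, h2.1]
    have b : fn (u₁ 0) = fn (u₂ 0) := by
      apply Lp.ext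
      filter_upwards [h₁.initial, h₂.initial] with x h1 h2
      rw [h1.2, h2.2]
    simp [hE, a, b]
  have hz : ∀ t ∈ Icc 0 T, fn (p₁ t) = fn (p₂ t) ∧ fn (u₁ t) = fn (u₂ t) := by
    intro t ht
    have e := hanti (left_mem_Icc.2 hT) ht ht.1
    rw [h0] at e
    have a := sq_nonneg ‖fn (p₁ t) - fn (p₂ t)‖
    have b := sq_nonneg ‖fn (u₁ t) - fn (u₂ t)‖
    have a' : ‖fn (p₁ t) - fn (p₂ t)‖ ^ 2 = 0 := by simp only [hE] at e; linarith
    have b' : ‖fn (u₁ t) - fn (u₂ t)‖ ^ 2 = 0 := by simp only [hE] at e; linarith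
    exact ⟨sub_eq_zero.1 (norm_eq_zero.1 (pow_eq_zero_iff two_ne_zero |>.1 a')),
      sub_eq_zero.1 (norm_eq_zero.1 (pow_eq_zero_iff two_ne_zero |>.1 b'))⟩
  exact ⟨fun t ht => Sob.ext_fn (hz t ht).1, fun t ht => Sob.ext_fn (hz t ht).2⟩

/-! ### Damping laws -/

theorem IsWeakDeriv.of_univ {f g : ℝ → ℝ} (h : IsWeakDeriv univ f g) (l r : ℝ) :
    IsWeakDeriv (Ioo l r) f g := by
  intro φ h1 h2 h3
  rw [setIntegral_testFunction h3, setIntegral_testFunction (tsupport_deriv_subset' h3)]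
  simpa using h φ h1 h2 (subset_univ _)

theorem IsWeakDeriv.univ_of_Ioo {f g : ℝ → ℝ}
    (h : ∀ l r : ℝ, l < r → IsWeakDeriv (Ioo l r) f g) : IsWeakDeriv univ f g := by
  intro φ h1 h2 _
  obtain ⟨R, hR⟩ := h2.isCompact.isBounded.subset_ball 0
  rw [Real.ball_eq_Ioo] at hR
  have hR' : tsupport φ ⊆ Ioo (-|R| - 1) (|R| + 1) := fun x hx => by
    have := hR hx
    simp only [mem_Ioo] at this ⊢
    constructor <;> linarith [le_abs_self R, this.1, this.2]
  have e := h (-|R| - 1) (|R| + 1) (by linarith [abs_nonneg R]) φ h1 h2 hR'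
  rw [setIntegral_testFunction hR', setIntegral_testFunction (tsupport_deriv_subset' hR')] at e
  simpa using e

theorem IsWeakDeriv.ae_eq_const_add_integral_univ {f g : ℝ → ℝ} (hf : LocallyIntegrable f)
    (hg : LocallyIntegrable g) (h : IsWeakDeriv univ f g) :
    ∃ c : ℝ, f =ᵐ[volume] fun x => c + ∫ t in (0 : ℝ)..x, g t := by
  have key : ∀ n : ℕ, ∃ c : ℝ, ∀ᵐ x, x ∈ Ioo (-(n : ℝ) - 1) (n + 1) →
      f x = c + ∫ t in (0 : ℝ)..x, g t := by
    intro n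
    have hn : (0 : ℝ) ≤ n := n.cast_nonneg
    obtain ⟨c, hc⟩ := (h.of_univ (-(n : ℝ) - 1) (n + 1)).ae_eq_const_add_integral (by linarith)
      ((hf.integrableOn_isCompact isCompact_Icc).mono_set Ioo_subset_Icc_self)
      ((hg.integrableOn_isCompact isCompact_Icc).mono_set Ioo_subset_Icc_self)
    refine ⟨c + ∫ t in (-(n : ℝ) - 1)..0, g t, ?_⟩
    rw [Filter.EventuallyEq, ae_restrict_iff' measurableSet_Ioo] at hc
    filter_upwards [hc] with x hx hm
    rw [hx hm, add_assoc, intervalIntegral.integral_add_adjacent_intervals] <;>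
    exact (hg.integrableOn_isCompact isCompact_uIcc).intervalIntegrable
  choose c hc using key
  have hcc : ∀ n, c n = c 0 := by
    intro n
    have : ∃ x ∈ Ioo (-1 : ℝ) 1, f x = c n + (∫ t in (0 : ℝ)..x, g t) ∧
        f x = c 0 + ∫ t in (0 : ℝ)..x, g t := by
      by_contra hh
      push Not at hh
      have h0 : ∀ᵐ x : ℝ, x ∉ Ioo (-1 : ℝ) 1 := by
        filter_upwards [hc n, hc 0] with x h1 h2 hm
        have hn : (0 : ℝ) ≤ n := n.cast_nonneg
        exact hh x hm (h1 ⟨by linarith [hm.1], by linarith [hm.2]⟩) (h2 (by simpa using hm))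
      have hv := ae_iff.1 h0
      simp only [not_not] at hv
      change volume (Ioo (-1 : ℝ) 1) = 0 at hv
      rw [Real.volume_Ioo] at hv
      norm_num at hv
    obtain ⟨x, _, h1, h2⟩ := this
    linarith
  refine ⟨c 0, ?_⟩
  filter_upwards [ae_all_iff.2 hc] with x hx
  obtain ⟨n, hn⟩ := exists_nat_gt |x|
  rw [← hcc n]
  have := abs_lt.1 hn
  exact hx n ⟨by linarith, by linarith⟩

/-- The classical form of (A1): `A` is twice continuously differentiable with derivatives `A'` and
`A''`, and `A''` is Lipschitz continuous. -/
structure IsLaw (a₀ a₁ a₂ a₃ : ℝ) (A A' A'' : ℝ → ℝ) : Prop where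
  zero : A 0 = 0
  hasDerivAt : ∀ x, HasDerivAt A (A' x) x
  hasDerivAt' : ∀ x, HasDerivAt A' (A'' x) x
  lower : ∀ x, a₀ ≤ A' x
  upper : ∀ x, A' x ≤ a₁
  abs_le : ∀ x, |A'' x| ≤ a₂
  lipschitz : ∀ x y, |A'' x - A'' y| ≤ a₃ * |x - y|

theorem forall_of_ae_of_isClosed {f : ℝ → ℝ} (hf : Continuous f) {s : Set ℝ} (hs : IsClosed s)
    (h : ∀ᵐ x, f x ∈ s) : ∀ x, f x ∈ s := by
  have hd : Dense {x | f x ∈ s} := Measure.dense_of_ae h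
  intro x
  have := hd.closure_eq ▸ mem_univ x
  rwa [show {x | f x ∈ s} = f ⁻¹' s from rfl, (hs.preimage hf).closure_eq] at this

theorem A1.exists_isLaw {a₀ a₁ a₂ a₃ : ℝ} {A : ℝ → ℝ} (h : A1 a₀ a₁ a₂ a₃ A) :
    ∃ A' A'' : ℝ → ℝ, IsLaw a₀ a₁ a₂ a₃ A A' A'' := by
  obtain ⟨hc, h0, d₁, d₂, d₃, i1, i2, i3, w1, w2, w3, b1, b2, b3⟩ := h
  obtain ⟨c₂, e₂⟩ := w3.ae_eq_const_add_integral_univ i2 i3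
  obtain ⟨c₁, e₁⟩ := w2.ae_eq_const_add_integral_univ i1 i2
  obtain ⟨c₀, e₀⟩ := w1.ae_eq_const_add_integral_univ hc.locallyIntegrable i1
  have ii : ∀ x y, IntervalIntegrable d₃ volume x y := fun x y =>
    (i3.integrableOn_isCompact isCompact_uIcc).intervalIntegrable
  set A'' : ℝ → ℝ := fun x => c₂ + ∫ t in (0 : ℝ)..x, d₃ t with hA''
  have lip : ∀ x y, |A'' x - A'' y| ≤ a₃ * |x - y| := by
    intro x y
    have : A'' x - A'' y = ∫ t in y..x, d₃ t := by
      rw [hA'', add_sub_add_left_eq_sub, intervalIntegral.integral_interval_sub_left (ii _ _) (ii _ _)]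
    rw [this, ← Real.norm_eq_abs]
    refine intervalIntegral.norm_integral_le_of_norm_le_const_ae ?_
    filter_upwards [b3] with t ht _
    exact ht
  have cA'' : Continuous A'' :=
    (LipschitzWith.of_dist_le' (K := a₃) (fun x y => by
      rw [Real.dist_eq, Real.dist_eq]; exact lip x y)).continuous
  set A' : ℝ → ℝ := fun x => c₁ + ∫ t in (0 : ℝ)..x, A'' t with hA'
  have dA' : ∀ x, HasDerivAt A' (A'' x) x := fun x =>
    (intervalIntegral.integral_hasDerivAt_right (cA''.intervalIntegrable _ _)
      cA''.stronglyMeasurable.stronglyMeasurableAtFilter cA''.continuousAt).const_add c₁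
  have cA' : Continuous A' := continuous_iff_continuousAt.2 fun x => (dA' x).continuousAt
  have E₁ : d₁ =ᵐ[volume] A' := by
    filter_upwards [e₁] with x hx
    rw [hx, hA']
    simp only
    rw [intervalIntegral.integral_congr_ae]
    filter_upwards [e₂] with t ht _
    exact ht
  set B : ℝ → ℝ := fun x => c₀ + ∫ t in (0 : ℝ)..x, A' t with hB
  have dB : ∀ x, HasDerivAt B (A' x) x := fun x =>
    (intervalIntegral.integral_hasDerivAt_right (cA'.intervalIntegrable _ _)
      cA'.stronglyMeasurable.stronglyMeasurableAtFilter cA'.continuousAt).const_add c₀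
  have cB : Continuous B := continuous_iff_continuousAt.2 fun x => (dB x).continuousAt
  have E₀ : A = B := by
    rw [← hc.ae_eq_iff_eq volume cB]
    filter_upwards [e₀] with x hx
    rw [hx, hB]
    simp only
    rw [intervalIntegral.integral_congr_ae]
    filter_upwards [E₁] with t ht _
    exact ht
  have bA' : ∀ x, A' x ∈ Icc a₀ a₁ := forall_of_ae_of_isClosed cA' isClosed_Icc (by
    filter_upwards [b1, E₁] with x h1 h2
    rw [← h2]
    exact h1)
  have bA'' : ∀ x, |A'' x| ∈ Iic a₂ := forall_of_ae_of_isClosed cA''.abs isClosed_Iic (by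
    filter_upwards [b2, e₂] with x h1 h2
    rw [← h2]
    exact h1)
  exact ⟨A', A'', h0, fun x => E₀ ▸ dB x, dA', fun x => (bA' x).1, fun x => (bA' x).2, bA'', lip⟩

theorem isWeakDeriv_univ_of_hasDerivAt {f f' : ℝ → ℝ} (hd : ∀ x, HasDerivAt f (f' x) x)
    (hc : Continuous f') : IsWeakDeriv univ f f' :=
  .univ_of_Ioo fun _ _ h => isWeakDeriv_of_hasDerivAt h
    (continuous_iff_continuousAt.2 fun x => (hd x).continuousAt).continuousOn hc.continuousOn
    fun x _ => hd x

theorem IsLaw.continuous_snd {a₀ a₁ a₂ a₃ : ℝ} {A A' A'' : ℝ → ℝ}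
    (h : IsLaw a₀ a₁ a₂ a₃ A A' A'') : Continuous A'' :=
  (LipschitzWith.of_dist_le' (K := a₃) (fun x y => by
    rw [Real.dist_eq, Real.dist_eq]; exact h.lipschitz x y)).continuous

theorem IsLaw.continuous_fst {a₀ a₁ a₂ a₃ : ℝ} {A A' A'' : ℝ → ℝ}
    (h : IsLaw a₀ a₁ a₂ a₃ A A' A'') : Continuous A' :=
  continuous_iff_continuousAt.2 fun x => (h.hasDerivAt' x).continuousAt

theorem IsLaw.continuous {a₀ a₁ a₂ a₃ : ℝ} {A A' A'' : ℝ → ℝ}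
    (h : IsLaw a₀ a₁ a₂ a₃ A A' A'') : Continuous A :=
  continuous_iff_continuousAt.2 fun x => (h.hasDerivAt x).continuousAt

theorem IsLaw.a1 {a₀ a₁ a₂ a₃ : ℝ} {A A' A'' : ℝ → ℝ} (h : IsLaw a₀ a₁ a₂ a₃ A A' A'') :
    A1 a₀ a₁ a₂ a₃ A := by
  have lip : LipschitzWith (Real.toNNReal a₃) A'' := LipschitzWith.of_dist_le' (K := a₃)
    (fun x y => by rw [Real.dist_eq, Real.dist_eq]; exact h.lipschitz x y)
  have ha₃ : 0 ≤ a₃ := by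
    have := (abs_nonneg _).trans (h.lipschitz 1 0)
    simpa using this
  have hb : ∀ x, |deriv A'' x| ≤ a₃ := fun x => by
    have := norm_deriv_le_of_lipschitz (x₀ := x) lip
    rwa [Real.coe_toNNReal _ ha₃] at this
  refine ⟨h.continuous, h.zero, A', A'', deriv A'', h.continuous_fst.locallyIntegrable,
    h.continuous_snd.locallyIntegrable, ?_, isWeakDeriv_univ_of_hasDerivAt h.hasDerivAt
      h.continuous_fst, isWeakDeriv_univ_of_hasDerivAt h.hasDerivAt' h.continuous_snd, ?_,
    .of_forall fun x => ⟨h.lower x, h.upper x⟩, .of_forall h.abs_le, .of_forall hb⟩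
  · exact (continuous_const (y := a₃)).locallyIntegrable.mono
      (measurable_deriv A'').aestronglyMeasurable
      (.of_forall fun x => (hb x).trans (le_abs_self a₃))
  · exact .univ_of_Ioo fun l r hlr => AbsolutelyContinuousOnInterval.isWeakDeriv hlr
      lip.lipschitzOnWith.absolutelyContinuousOnInterval (.of_forall fun _ => rfl)

theorem IsLaw.monotone {a₀ a₁ a₂ a₃ : ℝ} {A A' A'' : ℝ → ℝ} (h : IsLaw a₀ a₁ a₂ a₃ A A' A'')
    (h0 : 0 ≤ a₀) : Monotone A :=
  monotone_of_deriv_nonneg (fun x => (h.hasDerivAt x).differentiableAt) fun x => by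
    rw [(h.hasDerivAt x).deriv]
    exact h0.trans (h.lower x)

/-! ### Reflection -/

/-- The even `2`-periodic function which is the identity on `[0, 1]`. -/
noncomputable def fold (y : ℝ) : ℝ := Real.arccos (Real.cos (Real.pi * y)) / Real.pi

/-- The odd `2`-periodic function which is `1` on `(0, 1)`; it is the derivative of `fold`. -/
noncomputable def sgn (y : ℝ) : ℝ := Real.sin (Real.pi * y) / |Real.sin (Real.pi * y)|

theorem continuous_fold : Continuous fold := by
  unfold fold
  exact (Real.continuous_arccos.comp (by fun_prop)).div_const _

theorem measurable_sgn : Measurable sgn := by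
  unfold sgn
  have h : Measurable fun y : ℝ => Real.sin (Real.pi * y) :=
    (by fun_prop : Continuous fun y : ℝ => Real.sin (Real.pi * y)).measurable
  exact h.div h.abs

theorem fold_mem (y : ℝ) : fold y ∈ Icc (0 : ℝ) 1 :=
  ⟨div_nonneg (Real.arccos_nonneg _) Real.pi_pos.le,
    (div_le_one Real.pi_pos).2 (Real.arccos_le_pi _)⟩

theorem fold_of_mem {x : ℝ} (hx : x ∈ Icc (0 : ℝ) 1) : fold x = x := by
  unfold fold
  rw [Real.arccos_cos (mul_nonneg Real.pi_pos.le hx.1)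
    (by nlinarith [hx.2, Real.pi_pos]), mul_div_cancel_left₀ _ Real.pi_ne_zero]

theorem fold_neg (x : ℝ) : fold (-x) = fold x := by simp [fold]

theorem sgn_neg (x : ℝ) : sgn (-x) = -sgn x := by simp [sgn, neg_div]

theorem fold_add_two (x : ℝ) : fold (x + 2) = fold x := by
  rw [fold, show Real.pi * (x + 2) = Real.pi * x + 2 * Real.pi by ring, Real.cos_add_two_pi, fold]

theorem sgn_add_two (x : ℝ) : sgn (x + 2) = sgn x := by
  rw [sgn, show Real.pi * (x + 2) = Real.pi * x + 2 * Real.pi by ring, Real.sin_add_two_pi, sgn]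

theorem sin_pi_mul_pos {x : ℝ} (hx : x ∈ Ioo (0 : ℝ) 1) : 0 < Real.sin (Real.pi * x) :=
  Real.sin_pos_of_pos_of_lt_pi (mul_pos Real.pi_pos hx.1) (by nlinarith [hx.2, Real.pi_pos])

theorem sgn_of_mem {x : ℝ} (hx : x ∈ Ioo (0 : ℝ) 1) : sgn x = 1 := by
  have := sin_pi_mul_pos hx
  rw [sgn, abs_of_pos this, div_self this.ne']

theorem abs_sgn_le (x : ℝ) : |sgn x| ≤ 1 := by
  rw [sgn, abs_div, abs_abs]
  exact div_self_le_one _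

theorem hasDerivAt_fold {y : ℝ} (hy : Real.sin (Real.pi * y) ≠ 0) : HasDerivAt fold (sgn y) y := by
  have hsq := Real.sin_sq_add_cos_sq (Real.pi * y)
  have hpos : 0 < Real.sin (Real.pi * y) ^ 2 := by positivity
  have h1 : Real.cos (Real.pi * y) ≠ -1 := fun h => by rw [h] at hsq; linarith
  have h2 : Real.cos (Real.pi * y) ≠ 1 := fun h => by rw [h] at hsq; linarith
  have h3 : HasDerivAt (fun y : ℝ => Real.cos (Real.pi * y))
      (-Real.sin (Real.pi * y) * (Real.pi * 1)) y :=
    ((hasDerivAt_id y).const_mul Real.pi).cos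
  convert! ((Real.hasDerivAt_arccos h1 h2).comp y h3).div_const Real.pi using 1
  rw [← Real.sin_sq, Real.sqrt_sq_eq_abs, sgn]
  field_simp

theorem continuousAt_sgn {y : ℝ} (hy : Real.sin (Real.pi * y) ≠ 0) : ContinuousAt sgn y := by
  unfold sgn
  have h : ContinuousAt (fun y : ℝ => Real.sin (Real.pi * y)) y := by fun_prop
  exact h.div h.abs (abs_ne_zero.2 hy)

theorem countable_sin_eq_zero : {y : ℝ | Real.sin (Real.pi * y) = 0}.Countable := by
  refine (countable_range fun n : ℤ => (n : ℝ)).mono fun y hy => ?_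
  obtain ⟨n, hn⟩ := Real.sin_eq_zero_iff.1 hy
  exact ⟨n, mul_left_cancel₀ Real.pi_ne_zero (by rw [← hn]; ring)⟩

theorem countable_sin_comp_eq_zero {f : ℝ → ℝ} (hf : Function.Injective f) :
    {σ : ℝ | Real.sin (Real.pi * f σ) = 0}.Countable :=
  countable_sin_eq_zero.preimage hf

theorem ae_sin_comp_ne_zero {f : ℝ → ℝ} (hf : Function.Injective f) :
    ∀ᵐ σ : ℝ, Real.sin (Real.pi * f σ) ≠ 0 :=
  ae_iff.2 (by simpa using (countable_sin_comp_eq_zero hf).measure_zero volume)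

theorem intervalIntegrable_of_bound {f : ℝ → ℝ} (hf : Measurable f) {a b C : ℝ}
    (h : ∀ x ∈ uIcc a b, |f x| ≤ C) : IntervalIntegrable f volume a b := by
  refine (intervalIntegrable_const (c := C)).mono_fun hf.aestronglyMeasurable ?_
  filter_upwards [ae_restrict_mem measurableSet_uIoc] with x hx
  exact (h x (uIoc_subset_uIcc hx)).trans (le_abs_self C)

theorem intervalIntegrable_sgn (a b : ℝ) : IntervalIntegrable sgn volume a b :=
  intervalIntegrable_of_bound measurable_sgn fun x _ => abs_sgn_le x

theorem abs_fold_sub_le (x y : ℝ) : |fold x - fold y| ≤ |x - y| := by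
  rw [← integral_eq_of_hasDerivAt_off_countable fold sgn countable_sin_eq_zero
    continuous_fold.continuousOn (fun z hz => hasDerivAt_fold hz.2) (intervalIntegrable_sgn y x),
    ← Real.norm_eq_abs]
  simpa using intervalIntegral.norm_integral_le_of_norm_le_const
    (a := y) (b := x) (C := 1) (f := sgn) fun z _ => abs_sgn_le z

/-- Change of the order of integration over a triangle. -/
theorem integral_triangle_swap {t C : ℝ} (ht : 0 ≤ t) {g : ℝ → ℝ → ℝ}
    (hm : Measurable (Function.uncurry g))
    (hb : ∀ σ s, 0 ≤ σ → σ ≤ s → s ≤ t → |g σ s| ≤ C) :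
    ∫ s in 0..t, ∫ σ in 0..s, g σ s = ∫ σ in 0..t, ∫ s in σ..t, g σ s := by
  classical
  have hC : 0 ≤ C := (abs_nonneg _).trans (hb 0 0 le_rfl le_rfl ht)
  set S : Set (ℝ × ℝ) := {z | 0 ≤ z.2 ∧ z.2 ≤ z.1 ∧ z.1 ≤ t} with hS
  have hSm : MeasurableSet S :=
    (measurableSet_le measurable_const measurable_snd).inter
      ((measurableSet_le measurable_snd measurable_fst).inter
        (measurableSet_le measurable_fst measurable_const))
  set G : ℝ × ℝ → ℝ := S.indicator fun z => g z.2 z.1 with hG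
  have hGm : Measurable G := (hm.comp measurable_swap).indicator hSm
  have hGb : ∀ z, |G z| ≤ C := by
    intro z
    rw [hG]
    by_cases hz : z ∈ S
    · rw [indicator_of_mem hz]
      exact hb _ _ hz.1 hz.2.1 hz.2.2
    · rw [indicator_of_notMem hz]
      simpa using hC
  have hi : ∀ s σ, 0 ≤ σ → σ ≤ s → s ≤ t → G (s, σ) = g σ s := fun s σ h1 h2 h3 =>
    indicator_of_mem (show (s, σ) ∈ S from ⟨h1, h2, h3⟩) _
  have h0 : ∀ s σ, s < σ → G (s, σ) = 0 := fun s σ h =>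
    indicator_of_notMem (fun hz => absurd hz.2.1 (not_le.2 h)) _
  have m1 : ∀ s, Measurable fun σ => G (s, σ) := fun s => hGm.comp measurable_prodMk_left
  have m2 : ∀ σ, Measurable fun s => G (s, σ) := fun σ => hGm.comp measurable_prodMk_right
  have e1 : ∀ s ∈ uIcc 0 t, ∫ σ in 0..s, g σ s = ∫ σ in 0..t, G (s, σ) := by
    intro s hs
    rw [uIcc_of_le ht] at hs
    rw [← intervalIntegral.integral_add_adjacent_intervals (b := s)
      (intervalIntegrable_of_bound (m1 s) fun σ _ => hGb (s, σ))
      (intervalIntegrable_of_bound (m1 s) fun σ _ => hGb (s, σ)),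
      intervalIntegral.integral_zero_ae (a := s), add_zero]
    · refine intervalIntegral.integral_congr fun σ hσ => ?_
      rw [uIcc_of_le hs.1] at hσ
      exact (hi s σ hσ.1 hσ.2 hs.2).symm
    · refine .of_forall fun σ hσ => ?_
      rw [uIoc_of_le hs.2] at hσ
      exact h0 s σ hσ.1
  have e2 : ∀ σ ∈ uIcc 0 t, ∫ s in σ..t, g σ s = ∫ s in 0..t, G (s, σ) := by
    intro σ hσ
    rw [uIcc_of_le ht] at hσ
    rw [← intervalIntegral.integral_add_adjacent_intervals (b := σ)
      (intervalIntegrable_of_bound (m2 σ) fun s _ => hGb (s, σ))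
      (intervalIntegrable_of_bound (m2 σ) fun s _ => hGb (s, σ)),
      intervalIntegral.integral_zero_ae (a := 0), zero_add]
    · refine intervalIntegral.integral_congr fun s hs => ?_
      rw [uIcc_of_le hσ.2] at hs
      exact (hi s σ hσ.1 hs.1 hs.2).symm
    · filter_upwards [compl_mem_ae_iff.2 (measure_singleton σ)] with s hne hs
      rw [uIoc_of_le hσ.1] at hs
      exact h0 s σ (lt_of_le_of_ne hs.2 hne)
  rw [intervalIntegral.integral_congr e1, intervalIntegral.integral_congr e2]
  refine intervalIntegral_intervalIntegral_swap (F := fun s σ => G (s, σ)) ?_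
  refine Measure.integrableOn_of_bounded (M := C) (ne_top_of_le_ne_top
    (isCompact_uIcc.prod isCompact_uIcc).measure_lt_top.ne
    (measure_mono (prod_mono uIoc_subset_uIcc uIoc_subset_uIcc)))
    hGm.aestronglyMeasurable (.of_forall hGb)

/-! ### The Duhamel operator -/

/-- The solution `w` of `∂ₜw + ∂ₓw = k̃`, `w(·, 0) = 0`, where `k̃` is the odd `2`-periodic extension
in `x` of the function `k` on `[0, 1]`. -/
noncomputable def duhamel (k : ℝ → ℝ → ℝ) (x t : ℝ) : ℝ :=
  ∫ σ in 0..t, sgn (x - σ) * k (fold (x - σ)) (t - σ)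

theorem exists_bound_of_continuous {k : ℝ → ℝ → ℝ} (hk : Continuous (Function.uncurry k)) (R : ℝ) :
    ∃ C, ∀ y τ, |τ| ≤ R → |k (fold y) τ| ≤ C := by
  obtain ⟨C, hC⟩ := (isCompact_Icc.prod isCompact_Icc).exists_bound_of_continuousOn
    (s := Icc (0 : ℝ) 1 ×ˢ Icc (-R) R) hk.continuousOn
  exact ⟨C, fun y τ h => hC (fold y, τ) ⟨fold_mem y, abs_le.1 h⟩⟩

theorem measurable_duhamel_integrand {α : Type*} [MeasurableSpace α] {k : ℝ → ℝ → ℝ}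
    (hk : Continuous (Function.uncurry k)) {f g : α → ℝ} (hf : Measurable f) (hg : Measurable g) :
    Measurable fun a => sgn (f a) * k (fold (f a)) (g a) :=
  (measurable_sgn.comp hf).mul
    (hk.measurable.comp ((continuous_fold.measurable.comp hf).prodMk hg))

theorem intervalIntegrable_duhamel {k : ℝ → ℝ → ℝ} (hk : Continuous (Function.uncurry k))
    (x t a b : ℝ) :
    IntervalIntegrable (fun σ => sgn (x - σ) * k (fold (x - σ)) (t - σ)) volume a b := by
  obtain ⟨C, hC⟩ := exists_bound_of_continuous hk (|t| + (|a| + |b|))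
  refine intervalIntegrable_of_bound (C := 1 * C)
    (measurable_duhamel_integrand hk (by fun_prop) (by fun_prop)) fun σ hσ => ?_
  rw [abs_mul]
  refine mul_le_mul (abs_sgn_le _) (hC _ _ ?_) (abs_nonneg _) zero_le_one
  have h1 : |σ| ≤ |a| + |b| := by
    rcases mem_uIcc.1 hσ with h | h <;>
    exact abs_le.2 ⟨by linarith [neg_abs_le a, neg_abs_le b, abs_nonneg a, abs_nonneg b],
      by linarith [le_abs_self a, le_abs_self b, abs_nonneg a, abs_nonneg b]⟩
  linarith [abs_sub t σ]

theorem duhamel_sub {k₁ k₂ : ℝ → ℝ → ℝ} (h₁ : Continuous (Function.uncurry k₁))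
    (h₂ : Continuous (Function.uncurry k₂)) (x t : ℝ) :
    duhamel (fun y τ => k₁ y τ - k₂ y τ) x t = duhamel k₁ x t - duhamel k₂ x t := by
  rw [duhamel, duhamel, duhamel, ← intervalIntegral.integral_sub
    (intervalIntegrable_duhamel h₁ _ _ _ _) (intervalIntegrable_duhamel h₂ _ _ _ _)]
  simp only [mul_sub]

theorem duhamel_zero_right (k : ℝ → ℝ → ℝ) (x : ℝ) : duhamel k x 0 = 0 := by simp [duhamel]

theorem duhamel_add_two (k : ℝ → ℝ → ℝ) (x t : ℝ) : duhamel k (x + 2) t = duhamel k x t := by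
  simp only [duhamel, show ∀ σ : ℝ, x + 2 - σ = x - σ + 2 by intro σ; ring, sgn_add_two,
    fold_add_two]

theorem abs_duhamel_le {k : ℝ → ℝ → ℝ} {C D μ t : ℝ} (hμ : 0 < μ) (hD : 0 ≤ D) (ht : 0 ≤ t)
    (h : ∀ y ∈ Icc (0 : ℝ) 1, ∀ τ ∈ Icc 0 t, |k y τ| ≤ C + D * Real.exp (μ * τ)) (x : ℝ) :
    |duhamel k x t| ≤ C * t + D / μ * Real.exp (μ * t) := by
  have hint : IntervalIntegrable (fun σ => C + D * Real.exp (μ * (t - σ))) volume 0 t :=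
    (by fun_prop : Continuous fun σ => C + D * Real.exp (μ * (t - σ))).intervalIntegrable _ _
  have e1 : |duhamel k x t| ≤ ∫ σ in 0..t, (C + D * Real.exp (μ * (t - σ))) := by
    rw [duhamel, ← Real.norm_eq_abs]
    refine intervalIntegral.norm_integral_le_of_norm_le ht (.of_forall fun σ hσ => ?_) hint
    rw [Real.norm_eq_abs, abs_mul]
    have := h _ (fold_mem (x - σ)) (t - σ) ⟨by linarith [hσ.2], by linarith [hσ.1]⟩
    nlinarith [abs_sgn_le (x - σ), abs_nonneg (sgn (x - σ)), abs_nonneg (k (fold (x - σ)) (t - σ))]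
  have e2 : ∫ σ in 0..t, (C + D * Real.exp (μ * (t - σ))) =
      C * t + D / μ * Real.exp (μ * t) - D / μ := by
    rw [intervalIntegral.integral_eq_sub_of_hasDerivAt
      (f := fun σ => C * σ - D / μ * Real.exp (μ * (t - σ))) (fun σ _ => ?_) hint]
    · simp
      ring
    · have h1 : HasDerivAt (fun σ : ℝ => μ * (t - σ)) (μ * (-1)) σ :=
        ((hasDerivAt_id σ).const_sub t).const_mul μ
      convert! ((hasDerivAt_id σ).const_mul C).sub (h1.exp.const_mul (D / μ)) using 1
      field_simp
      ring
  have : 0 ≤ D / μ := by positivity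
  linarith

theorem continuous_duhamel {k : ℝ → ℝ → ℝ} (hk : Continuous (Function.uncurry k)) :
    Continuous fun z : ℝ × ℝ => duhamel k z.1 z.2 := by
  set Φ : ℝ × ℝ → ℝ → ℝ := fun z θ =>
    z.2 * (sgn (z.1 - z.2 * θ) * k (fold (z.1 - z.2 * θ)) (z.2 - z.2 * θ)) with hΦ
  have e : (fun z : ℝ × ℝ => duhamel k z.1 z.2) = fun z => ∫ θ in (0 : ℝ)..1, Φ z θ := by
    funext z
    have := intervalIntegral.mul_integral_comp_mul_left (a := 0) (b := 1) (c := z.2)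
      (f := fun σ => sgn (z.1 - σ) * k (fold (z.1 - σ)) (z.2 - σ))
    rw [mul_zero, mul_one] at this
    rw [duhamel, ← this, hΦ, intervalIntegral.integral_const_mul]
  rw [e, continuous_iff_continuousAt]
  intro z₀
  obtain ⟨C, hC⟩ := exists_bound_of_continuous hk (|z₀.2| + 1)
  have hC0 : 0 ≤ C := (abs_nonneg _).trans (hC 0 0 (by simp; positivity))
  have near : ∀ᶠ z : ℝ × ℝ in nhds z₀, |z.2| < |z₀.2| + 1 :=
    (continuous_snd.abs.continuousAt).eventually_lt continuousAt_const (by simp)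
  have hb : ∀ z : ℝ × ℝ, |z.2| < |z₀.2| + 1 → ∀ θ ∈ uIoc (0 : ℝ) 1, |Φ z θ| ≤ |z.2| * C := by
    intro z hz θ hθ
    rw [uIoc_of_le zero_le_one] at hθ
    rw [hΦ]
    simp only
    rw [abs_mul, abs_mul]
    refine mul_le_mul_of_nonneg_left ?_ (abs_nonneg _)
    have h1 : |k (fold (z.1 - z.2 * θ)) (z.2 - z.2 * θ)| ≤ C := by
      refine hC _ _ ?_
      rw [show z.2 - z.2 * θ = z.2 * (1 - θ) by ring, abs_mul,
        abs_of_nonneg (by linarith [hθ.2] : 0 ≤ 1 - θ)]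
      nlinarith [abs_nonneg z.2, hθ.1]
    nlinarith [abs_sgn_le (z.1 - z.2 * θ), abs_nonneg (sgn (z.1 - z.2 * θ)),
      abs_nonneg (k (fold (z.1 - z.2 * θ)) (z.2 - z.2 * θ))]
  refine intervalIntegral.continuousAt_of_dominated_interval
    (bound := fun _ => (|z₀.2| + 1) * C) ?_ ?_ intervalIntegrable_const ?_
  · refine .of_forall fun z => Measurable.aestronglyMeasurable ?_
    exact (measurable_duhamel_integrand hk (f := fun θ => z.1 - z.2 * θ)
      (g := fun θ => z.2 - z.2 * θ) (by fun_prop) (by fun_prop)).const_mul z.2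
  · filter_upwards [near] with z hz
    refine .of_forall fun θ hθ => (hb z hz θ hθ).trans ?_
    exact mul_le_mul_of_nonneg_right hz.le hC0
  · by_cases h0 : z₀.2 = 0
    · refine .of_forall fun θ hθ => ?_
      have hz : Φ z₀ θ = 0 := by rw [hΦ]; simp [h0]
      rw [ContinuousAt, hz]
      refine squeeze_zero_norm' (a := fun z : ℝ × ℝ => |z.2| * C) ?_ ?_
      · filter_upwards [near] with z hz
        exact hb z hz θ hθ
      · have : Continuous fun z : ℝ × ℝ => |z.2| * C := by fun_prop
        simpa [h0] using this.tendsto z₀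
    · have inj : Function.Injective fun θ : ℝ => z₀.1 - z₀.2 * θ := fun a b h =>
        mul_left_cancel₀ h0 (by simpa using h)
      filter_upwards [ae_sin_comp_ne_zero inj] with θ hθ _
      have c1 : ContinuousAt (fun z : ℝ × ℝ => sgn (z.1 - z.2 * θ)) z₀ :=
        ContinuousAt.comp (g := sgn) (f := fun z : ℝ × ℝ => z.1 - z.2 * θ) (continuousAt_sgn hθ)
          (by fun_prop)
      have c2 : Continuous fun z : ℝ × ℝ => k (fold (z.1 - z.2 * θ)) (z.2 - z.2 * θ) :=
        hk.comp ((continuous_fold.comp (by fun_prop)).prodMk (by fun_prop))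
      exact continuousAt_snd.mul (c1.mul c2.continuousAt)

theorem continuous_uncurry_integral {k : ℝ → ℝ → ℝ} (hk : Continuous (Function.uncurry k)) :
    Continuous (Function.uncurry fun x t => ∫ τ in 0..t, k x τ) := by
  have : Continuous (Function.uncurry fun (z : ℝ × ℝ) (τ : ℝ) => k z.1 τ) :=
    hk.comp (by fun_prop : Continuous fun w : (ℝ × ℝ) × ℝ => (w.1.1, w.2))
  exact intervalIntegral.continuous_parametric_intervalIntegral_of_continuous this continuous_snd

theorem intervalIntegrable_right {k : ℝ → ℝ → ℝ} (hk : Continuous (Function.uncurry k))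
    (x a b : ℝ) : IntervalIntegrable (k x) volume a b :=
  (hk.comp (by fun_prop : Continuous fun τ : ℝ => (x, τ))).intervalIntegrable _ _

/-- The Duhamel operator commutes with integration in time. -/
theorem duhamel_integral {k : ℝ → ℝ → ℝ} (hk : Continuous (Function.uncurry k)) {t : ℝ}
    (ht : 0 ≤ t) (x : ℝ) :
    duhamel (fun y s => ∫ τ in 0..s, k y τ) x t = ∫ s in 0..t, duhamel k x s := by
  obtain ⟨C, hC⟩ := exists_bound_of_continuous hk t
  simp only [duhamel]
  rw [integral_triangle_swap (C := C) ht
    (g := fun σ s => sgn (x - σ) * k (fold (x - σ)) (s - σ))]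
  · refine intervalIntegral.integral_congr fun σ _ => ?_
    rw [intervalIntegral.integral_const_mul,
      intervalIntegral.integral_comp_sub_right (fun τ => k (fold (x - σ)) τ), sub_self]
  · exact measurable_duhamel_integrand hk (f := fun z : ℝ × ℝ => x - z.1)
      (g := fun z => z.2 - z.1) (by fun_prop) (by fun_prop)
  · intro σ s h1 h2 h3
    rw [abs_mul]
    have := hC (x - σ) (s - σ) (by rw [abs_of_nonneg] <;> linarith)
    nlinarith [abs_sgn_le (x - σ), abs_nonneg (sgn (x - σ)), abs_nonneg (k (fold (x - σ)) (s - σ))]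

theorem integral_sgn_mul_fold {κ : ℝ → ℝ} (hκ : Continuous κ) (x a b : ℝ) :
    ∫ σ in a..b, sgn (x - σ) * κ (fold (x - σ)) =
      (∫ z in 0..fold (x - a), κ z) - ∫ z in 0..fold (x - b), κ z := by
  have inj : Function.Injective fun σ : ℝ => x - σ := sub_right_injective
  have hd : ∀ y, HasDerivAt (fun y => ∫ z in 0..y, κ z) (κ y) y := fun y =>
    intervalIntegral.integral_hasDerivAt_right (hκ.intervalIntegrable _ _)
      hκ.stronglyMeasurable.stronglyMeasurableAtFilter hκ.continuousAt
  have hc : Continuous fun y => ∫ z in 0..y, κ z :=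
    continuous_iff_continuousAt.2 fun y => (hd y).continuousAt
  have h := integral_eq_of_hasDerivAt_off_countable (a := a) (b := b)
    (fun σ => -∫ z in 0..fold (x - σ), κ z)
    (fun σ => sgn (x - σ) * κ (fold (x - σ))) (countable_sin_comp_eq_zero inj)
    (hc.comp (continuous_fold.comp (by fun_prop))).neg.continuousOn (fun σ hσ => by
      have h1 : HasDerivAt (fun σ : ℝ => x - σ) (-1) σ := (hasDerivAt_id σ).const_sub x
      have h2 := (hasDerivAt_fold hσ.2).comp σ h1
      convert! ((hd (fold (x - σ))).comp σ h2).neg using 1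
      ring)
    (by
      have := intervalIntegrable_duhamel (k := fun y _ => κ y) (hκ.comp continuous_fst) x 0 a b
      exact this)
  rw [h]
  ring

/-- The primitive in `x` of the odd extension. -/
theorem duhamel_integral_eq {k : ℝ → ℝ → ℝ} (hk : Continuous (Function.uncurry k)) {t : ℝ}
    (ht : 0 ≤ t) (x : ℝ) :
    duhamel (fun y s => ∫ τ in 0..s, k y τ) x t =
      (∫ z in 0..fold x, ∫ τ in 0..t, k z τ) -
        ∫ σ in 0..t, ∫ z in 0..fold (x - σ), k z (t - σ) := by
  obtain ⟨C, hC⟩ := exists_bound_of_continuous hk t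
  have hH : Continuous (Function.uncurry fun y τ => ∫ z in 0..y, k z τ) := by
    have : Continuous (Function.uncurry fun (z : ℝ × ℝ) (y : ℝ) => k y z.2) :=
      hk.comp (by fun_prop : Continuous fun w : (ℝ × ℝ) × ℝ => (w.2, w.1.2))
    exact intervalIntegral.continuous_parametric_intervalIntegral_of_continuous this continuous_fst
  have e0 : duhamel (fun y s => ∫ τ in 0..s, k y τ) x t =
      ∫ σ in 0..t, ∫ s in σ..t, sgn (x - σ) * k (fold (x - σ)) (t - s) := by
    rw [duhamel]
    refine intervalIntegral.integral_congr fun σ _ => ?_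
    rw [intervalIntegral.integral_const_mul,
      intervalIntegral.integral_comp_sub_left (fun τ => k (fold (x - σ)) τ), sub_self]
  rw [e0, ← integral_triangle_swap (C := C) ht
    (g := fun σ s => sgn (x - σ) * k (fold (x - σ)) (t - s))]
  · have e1 : ∀ s, ∫ σ in 0..s, sgn (x - σ) * k (fold (x - σ)) (t - s) =
        (∫ z in 0..fold x, k z (t - s)) - ∫ z in 0..fold (x - s), k z (t - s) := by
      intro s
      rw [integral_sgn_mul_fold (κ := fun y => k y (t - s))
        (hk.comp (by fun_prop : Continuous fun y => (y, t - s))), sub_zero]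
    simp only [e1]
    rw [intervalIntegral.integral_sub]
    · congr 1
      rw [intervalIntegral.integral_comp_sub_left (fun τ => ∫ z in 0..fold x, k z τ), sub_self,
        sub_zero, intervalIntegral_intervalIntegral_swap]
      refine (hk.comp continuous_swap).continuousOn.integrableOn_compact
        (isCompact_uIcc.prod isCompact_uIcc) |>.mono_set (prod_mono uIoc_subset_uIcc uIoc_subset_uIcc)
    · exact (hH.comp (by fun_prop : Continuous fun s => (fold x, t - s))).intervalIntegrable _ _
    · exact (hH.comp ((continuous_fold.comp (by fun_prop : Continuous fun s => x - s)).prodMk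
        (by fun_prop : Continuous fun s => t - s))).intervalIntegrable _ _
  · exact measurable_duhamel_integrand hk (f := fun z : ℝ × ℝ => x - z.1)
      (g := fun z => t - z.2) (by fun_prop) (by fun_prop)
  · intro σ s h1 h2 h3
    rw [abs_mul]
    have := hC (x - σ) (t - s) (by rw [abs_of_nonneg] <;> linarith)
    nlinarith [abs_sgn_le (x - σ), abs_nonneg (sgn (x - σ)), abs_nonneg (k (fold (x - σ)) (t - s))]

theorem hasDerivAt_duhamel {k : ℝ → ℝ → ℝ} (hk : Continuous (Function.uncurry k)) {t : ℝ}
    (ht : 0 ≤ t) {x : ℝ} (hx : Real.sin (Real.pi * x) ≠ 0) :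
    HasDerivAt (fun x => duhamel (fun y s => ∫ τ in 0..s, k y τ) x t)
      (sgn x * (∫ τ in 0..t, k (fold x) τ) - duhamel k x t) x := by
  obtain ⟨C, hC⟩ := exists_bound_of_continuous hk t
  have hH : Continuous (Function.uncurry fun y τ => ∫ z in 0..y, k z τ) := by
    have : Continuous (Function.uncurry fun (z : ℝ × ℝ) (y : ℝ) => k y z.2) :=
      hk.comp (by fun_prop : Continuous fun w : (ℝ × ℝ) × ℝ => (w.2, w.1.2))
    exact intervalIntegral.continuous_parametric_intervalIntegral_of_continuous this continuous_fst
  have hK : ∀ {κ : ℝ → ℝ}, Continuous κ → ∀ y, HasDerivAt (fun y => ∫ z in 0..y, κ z) (κ y) y :=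
    fun hκ y => intervalIntegral.integral_hasDerivAt_right (hκ.intervalIntegrable _ _)
      hκ.stronglyMeasurable.stronglyMeasurableAtFilter hκ.continuousAt
  have kc : ∀ τ, Continuous fun z => k z τ := fun τ =>
    hk.comp (by fun_prop : Continuous fun z => (z, τ))
  simp only [duhamel_integral_eq hk ht]
  refine HasDerivAt.sub ?_ ?_
  · have h1 : Continuous fun z => ∫ τ in 0..t, k z τ :=
      (continuous_uncurry_integral hk).comp (by fun_prop : Continuous fun z : ℝ => (z, t))
    convert! (hK h1 (fold x)).comp x (hasDerivAt_fold hx) using 1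
    ring
  · refine (intervalIntegral.hasDerivAt_integral_of_dominated_loc_of_lip (s := univ)
      (F := fun x σ => ∫ z in 0..fold (x - σ), k z (t - σ))
      (F' := fun σ => sgn (x - σ) * k (fold (x - σ)) (t - σ)) (bound := fun _ => C)
      Filter.univ_mem ?_ ?_ ?_ ?_ intervalIntegrable_const ?_).2
    · exact .of_forall fun y => (hH.comp ((continuous_fold.comp
        (by fun_prop : Continuous fun s => y - s)).prodMk
        (by fun_prop : Continuous fun s => t - s))).aestronglyMeasurable
    · exact (hH.comp ((continuous_fold.comp (by fun_prop : Continuous fun s => x - s)).prodMk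
        (by fun_prop : Continuous fun s => t - s))).intervalIntegrable _ _
    · exact (measurable_duhamel_integrand hk (f := fun σ => x - σ)
        (g := fun σ => t - σ) (by fun_prop) (by fun_prop)).aestronglyMeasurable
    · refine .of_forall fun σ hσ => LipschitzOnWith.of_dist_le_mul fun y _ y' _ => ?_
      rw [uIoc_of_le ht] at hσ
      have hτ : |t - σ| ≤ t := by rw [abs_of_nonneg] <;> linarith [hσ.1, hσ.2]
      have hC0 : 0 ≤ C := (abs_nonneg _).trans (hC 0 _ hτ)
      rw [Real.coe_nnabs, abs_of_nonneg hC0, Real.dist_eq, Real.dist_eq,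
        intervalIntegral.integral_interval_sub_left ((kc _).intervalIntegrable _ _)
          ((kc _).intervalIntegrable _ _), ← Real.norm_eq_abs]
      refine (intervalIntegral.norm_integral_le_of_norm_le_const (C := C) fun z hz => ?_).trans ?_
      · have hz1 : z ∈ Icc (0 : ℝ) 1 :=
          (convex_Icc (0 : ℝ) 1).ordConnected.uIcc_subset (fold_mem _) (fold_mem _)
            (uIoc_subset_uIcc hz)
        have := hC z (t - σ) hτ
        rwa [fold_of_mem hz1] at this
      · refine mul_le_mul_of_nonneg_left ((abs_fold_sub_le _ _).trans ?_) hC0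
        rw [show y - σ - (y' - σ) = y - y' by ring]
    · have inj : Function.Injective fun σ : ℝ => x - σ := sub_right_injective
      filter_upwards [ae_sin_comp_ne_zero inj] with σ hσ _
      have h1 : HasDerivAt (fun x : ℝ => x - σ) 1 x := (hasDerivAt_id x).sub_const σ
      have h2 := (hasDerivAt_fold hσ).comp x h1
      convert! (hK (kc (t - σ)) (fold (x - σ))).comp x h2 using 1
      ring

/-! ### The semilinear problem -/

/-- The primitive in time which vanishes at time `0`. -/
noncomputable def prim (k : ℝ → ℝ → ℝ) (x t : ℝ) : ℝ := ∫ τ in 0..t, k x τ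

theorem continuous_prim {k : ℝ → ℝ → ℝ} (hk : Continuous (Function.uncurry k)) :
    Continuous (Function.uncurry (prim k)) :=
  continuous_uncurry_integral hk

theorem hasDerivAt_prim {k : ℝ → ℝ → ℝ} (hk : Continuous (Function.uncurry k)) (x t : ℝ) :
    HasDerivAt (prim k x) (k x t) t := by
  have h : Continuous (k x) := hk.comp (by fun_prop : Continuous fun τ : ℝ => (x, τ))
  exact intervalIntegral.integral_hasDerivAt_right (h.intervalIntegrable _ _)
      h.stronglyMeasurable.stronglyMeasurableAtFilter h.continuousAt

@[simp] theorem prim_zero (k : ℝ → ℝ → ℝ) (x : ℝ) : prim k x 0 = 0 := by simp [prim]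

theorem eq_prim_of_hasDerivAt {f k : ℝ → ℝ → ℝ} (hk : Continuous (Function.uncurry k)) {x : ℝ}
    (h0 : f x 0 = 0) (hd : ∀ t, HasDerivAt (f x) (k x t) t) (t : ℝ) : f x t = prim k x t := by
  rw [prim, intervalIntegral.integral_eq_sub_of_hasDerivAt (fun τ _ => hd τ)
    (intervalIntegrable_right hk x 0 t), h0, sub_zero]

theorem abs_prim_le {k : ℝ → ℝ → ℝ} {C x t : ℝ} (ht : 0 ≤ t)
    (h : ∀ τ ∈ Icc 0 t, |k x τ| ≤ C) : |prim k x t| ≤ C * t := by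
  have := intervalIntegral.norm_integral_le_of_norm_le_const (a := 0) (b := t) (f := k x) (C := C)
    fun τ hτ => h τ (by rw [uIoc_of_le ht] at hτ; exact Ioc_subset_Icc_self hτ)
  rwa [sub_zero, abs_of_nonneg ht] at this

theorem prim_sub {k₁ k₂ : ℝ → ℝ → ℝ} (h₁ : Continuous (Function.uncurry k₁))
    (h₂ : Continuous (Function.uncurry k₂)) (x t : ℝ) :
    prim (fun y τ => k₁ y τ - k₂ y τ) x t = prim k₁ x t - prim k₂ x t :=
  intervalIntegral.integral_sub (intervalIntegrable_right h₁ _ _ _)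
    (intervalIntegrable_right h₂ _ _ _)

/-- The odd part in `x` of the solution of the transport equation. -/
noncomputable def oddPart (k : ℝ → ℝ → ℝ) (x t : ℝ) : ℝ := (duhamel k x t - duhamel k (-x) t) / 2

/-- The even part in `x` of the solution of the transport equation. -/
noncomputable def evenPart (k : ℝ → ℝ → ℝ) (x t : ℝ) : ℝ := (duhamel k x t + duhamel k (-x) t) / 2

theorem continuous_duhamel_comp {X : Type*} [TopologicalSpace X] {k : ℝ → ℝ → ℝ}
    (hk : Continuous (Function.uncurry k)) {f g : X → ℝ} (hf : Continuous f) (hg : Continuous g) :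
    Continuous fun z => duhamel k (f z) (g z) :=
  Continuous.comp (g := fun z : ℝ × ℝ => duhamel k z.1 z.2) (f := fun z => (f z, g z))
    (continuous_duhamel hk) (hf.prodMk hg)

theorem continuous_duhamel_neg {k : ℝ → ℝ → ℝ} (hk : Continuous (Function.uncurry k)) :
    Continuous fun z : ℝ × ℝ => duhamel k (-z.1) z.2 :=
  continuous_duhamel_comp hk continuous_fst.neg continuous_snd

theorem continuous_oddPart {k : ℝ → ℝ → ℝ} (hk : Continuous (Function.uncurry k)) :
    Continuous (Function.uncurry (oddPart k)) :=
  ((continuous_duhamel hk).sub (continuous_duhamel_neg hk)).div_const 2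

theorem continuous_evenPart {k : ℝ → ℝ → ℝ} (hk : Continuous (Function.uncurry k)) :
    Continuous (Function.uncurry (evenPart k)) :=
  ((continuous_duhamel hk).add (continuous_duhamel_neg hk)).div_const 2

theorem oddPart_zero (k : ℝ → ℝ → ℝ) (t : ℝ) : oddPart k 0 t = 0 := by simp [oddPart]

theorem oddPart_one (k : ℝ → ℝ → ℝ) (t : ℝ) : oddPart k 1 t = 0 := by
  rw [oddPart, show (1 : ℝ) = -1 + 2 by norm_num, duhamel_add_two]
  norm_num

theorem oddPart_prim {k : ℝ → ℝ → ℝ} (hk : Continuous (Function.uncurry k)) {t : ℝ} (ht : 0 ≤ t)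
    (x : ℝ) : oddPart (prim k) x t = prim (oddPart k) x t := by
  have c : ∀ x, Continuous fun s => duhamel k x s := fun x =>
    continuous_duhamel_comp hk continuous_const continuous_id
  have e := fun x => duhamel_integral hk ht x
  change ∀ x, duhamel (prim k) x t = _ at e
  simp only [oddPart, prim, intervalIntegral.integral_div]
  rw [intervalIntegral.integral_sub ((c _).intervalIntegrable _ _) ((c _).intervalIntegrable _ _),
    ← e, ← e]

theorem evenPart_prim {k : ℝ → ℝ → ℝ} (hk : Continuous (Function.uncurry k)) {t : ℝ} (ht : 0 ≤ t)
    (x : ℝ) : evenPart (prim k) x t = prim (evenPart k) x t := by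
  have c : ∀ x, Continuous fun s => duhamel k x s := fun x =>
    continuous_duhamel_comp hk continuous_const continuous_id
  have e := fun x => duhamel_integral hk ht x
  change ∀ x, duhamel (prim k) x t = _ at e
  simp only [evenPart, prim, intervalIntegral.integral_div]
  rw [intervalIntegral.integral_add ((c _).intervalIntegrable _ _) ((c _).intervalIntegrable _ _),
    ← e, ← e]

theorem hasDerivAt_duhamel_neg {k : ℝ → ℝ → ℝ} (hk : Continuous (Function.uncurry k)) {t : ℝ}
    (ht : 0 ≤ t) {x : ℝ} (hx : x ∈ Ioo (0 : ℝ) 1) :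
    HasDerivAt (fun x => duhamel (prim k) x t) (prim k x t - duhamel k x t) x ∧
      HasDerivAt (fun x => duhamel (prim k) (-x) t) (prim k x t + duhamel k (-x) t) x := by
  have hs := (sin_pi_mul_pos hx).ne'
  constructor
  · convert! hasDerivAt_duhamel hk ht hs using 1
    rw [sgn_of_mem hx, fold_of_mem (Ioo_subset_Icc_self hx), one_mul]
    rfl
  · have h := (hasDerivAt_duhamel hk ht (x := -x) (by simpa using hs)).comp x (hasDerivAt_neg x)
    convert! h using 1
    rw [sgn_neg, fold_neg, sgn_of_mem hx, fold_of_mem (Ioo_subset_Icc_self hx), prim]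
    ring

theorem hasDerivAt_oddPart {k : ℝ → ℝ → ℝ} (hk : Continuous (Function.uncurry k)) {t : ℝ}
    (ht : 0 ≤ t) {x : ℝ} (hx : x ∈ Ioo (0 : ℝ) 1) :
    HasDerivAt (fun x => oddPart (prim k) x t) (-evenPart k x t) x := by
  obtain ⟨h1, h2⟩ := hasDerivAt_duhamel_neg hk ht hx
  convert! (h1.sub h2).div_const 2 using 1
  rw [evenPart]
  ring

theorem hasDerivAt_evenPart {k : ℝ → ℝ → ℝ} (hk : Continuous (Function.uncurry k)) {t : ℝ}
    (ht : 0 ≤ t) {x : ℝ} (hx : x ∈ Ioo (0 : ℝ) 1) :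
    HasDerivAt (fun x => evenPart (prim k) x t) (prim k x t - oddPart k x t) x := by
  obtain ⟨h1, h2⟩ := hasDerivAt_duhamel_neg hk ht hx
  convert! (h1.add h2).div_const 2 using 1
  rw [oddPart]
  ring

theorem abs_oddPart_le {k : ℝ → ℝ → ℝ} {C D μ t : ℝ} (hμ : 0 < μ) (hD : 0 ≤ D) (ht : 0 ≤ t)
    (h : ∀ y ∈ Icc (0 : ℝ) 1, ∀ τ ∈ Icc 0 t, |k y τ| ≤ C + D * Real.exp (μ * τ)) (x : ℝ) :
    |oddPart k x t| ≤ C * t + D / μ * Real.exp (μ * t) := by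
  have h1 := abs_duhamel_le hμ hD ht h x
  have h2 := abs_duhamel_le hμ hD ht h (-x)
  rw [oddPart, abs_div, abs_two, div_le_iff₀ two_pos]
  linarith [abs_sub (duhamel k x t) (duhamel k (-x) t)]

theorem oddPart_sub {k₁ k₂ : ℝ → ℝ → ℝ} (h₁ : Continuous (Function.uncurry k₁))
    (h₂ : Continuous (Function.uncurry k₂)) (x t : ℝ) :
    oddPart (fun y τ => k₁ y τ - k₂ y τ) x t = oddPart k₁ x t - oddPart k₂ x t := by
  simp only [oddPart, duhamel_sub h₁ h₂]
  ring

/-- A weighted Gronwall inequality on `[0, 1] × [0, T]`. -/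
theorem abs_le_of_weighted {T C μ : ℝ} (hT : 0 ≤ T) {f : ℝ → ℝ → ℝ}
    (hf : Continuous (Function.uncurry f))
    (h : ∀ D, 0 ≤ D → (∀ x ∈ Icc (0 : ℝ) 1, ∀ t ∈ Icc 0 T, |f x t| ≤ D * Real.exp (μ * t)) →
      ∀ x ∈ Icc (0 : ℝ) 1, ∀ t ∈ Icc 0 T, |f x t| ≤ (C + D / 2) * Real.exp (μ * t)) :
    ∀ x ∈ Icc (0 : ℝ) 1, ∀ t ∈ Icc 0 T, |f x t| ≤ 2 * C * Real.exp (μ * t) := by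
  have hc : Continuous fun z : ℝ × ℝ => |f z.1 z.2| * Real.exp (-(μ * z.2)) :=
    hf.abs.mul (by fun_prop)
  obtain ⟨z₀, hz₀, hmax⟩ := (isCompact_Icc.prod isCompact_Icc).exists_isMaxOn
    (s := Icc (0 : ℝ) 1 ×ˢ Icc 0 T) ⟨(0, 0), by simp [hT]⟩ hc.continuousOn
  set D := |f z₀.1 z₀.2| * Real.exp (-(μ * z₀.2)) with hD
  have hD0 : 0 ≤ D := by positivity
  have hle : ∀ x ∈ Icc (0 : ℝ) 1, ∀ t ∈ Icc 0 T, |f x t| ≤ D * Real.exp (μ * t) := by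
    intro x hx t ht
    have := hmax (show (x, t) ∈ Icc (0 : ℝ) 1 ×ˢ Icc 0 T from ⟨hx, ht⟩)
    simp only [mem_ofPred_eq] at this
    rw [← hD, Real.exp_neg, ← div_eq_mul_inv, div_le_iff₀ (Real.exp_pos _)] at this
    exact this
  have h2 := h D hD0 hle z₀.1 hz₀.1 z₀.2 hz₀.2
  have h3 : D ≤ C + D / 2 := by
    rw [hD, Real.exp_neg, ← div_eq_mul_inv, div_le_iff₀ (Real.exp_pos _)]
    rwa [hD, Real.exp_neg, ← div_eq_mul_inv] at h2
  intro x hx t ht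
  refine (hle x hx t ht).trans ?_
  have := Real.exp_pos (μ * t)
  nlinarith

/-- A map which is contracting for a weighted norm has a fixed point. -/
theorem exists_fixedPoint_of_weighted {T μ : ℝ}
    (S : C(Icc (0 : ℝ) 1 × Icc (0 : ℝ) T, ℝ) → C(Icc (0 : ℝ) 1 × Icc (0 : ℝ) T, ℝ))
    (h : ∀ y₁ y₂ D, 0 ≤ D → (∀ q, |y₁ q - y₂ q| ≤ D * Real.exp (μ * q.2)) →
      ∀ q, |S y₁ q - S y₂ q| ≤ D / 2 * Real.exp (μ * q.2)) : ∃ y, S y = y := by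
  let e : C(Icc (0 : ℝ) 1 × Icc (0 : ℝ) T, ℝ) := ⟨fun q => Real.exp (μ * q.2), by fun_prop⟩
  let e' : C(Icc (0 : ℝ) 1 × Icc (0 : ℝ) T, ℝ) := ⟨fun q => Real.exp (-(μ * q.2)), by fun_prop⟩
  have hee : e * e' = 1 := by
    ext q
    simp only [e, e', ContinuousMap.mul_apply, ContinuousMap.coe_mk, ContinuousMap.one_apply]
    rw [← Real.exp_add]
    simp
  have hc : ContractingWith (1 / 2) fun y => e' * S (e * y) := by
    refine ⟨by norm_num, LipschitzWith.of_dist_le_mul fun y₁ y₂ => ?_⟩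
    rw [ContinuousMap.dist_le (by positivity)]
    intro q
    have h1 := h (e * y₁) (e * y₂) (dist y₁ y₂) dist_nonneg (fun q => by
      simp only [ContinuousMap.mul_apply, ← mul_sub, abs_mul]
      rw [mul_comm, abs_of_pos (show 0 < e q from Real.exp_pos _)]
      exact mul_le_mul_of_nonneg_right
        (ContinuousMap.dist_apply_le_dist (f := y₁) (g := y₂) q) (Real.exp_pos _).le) q
    simp only [ContinuousMap.mul_apply, Real.dist_eq, ← mul_sub, abs_mul]
    rw [abs_of_pos (show 0 < e' q from Real.exp_pos _)]
    calc e' q * |S (e * y₁) q - S (e * y₂) q|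
        ≤ e' q * (dist y₁ y₂ / 2 * e q) := mul_le_mul_of_nonneg_left h1 (Real.exp_pos _).le
      _ = dist y₁ y₂ / 2 * (e * e') q := by rw [ContinuousMap.mul_apply]; ring
      _ = _ := by rw [hee]; simp; ring
  refine ⟨e * hc.fixedPoint, ?_⟩
  have := hc.fixedPoint_isFixedPt
  have h2 : e * (e' * S (e * hc.fixedPoint)) = e * hc.fixedPoint := congrArg (e * ·) this
  rwa [← mul_assoc, hee, one_mul] at h2

/-- The time derivative of the lower order terms `∂ₜG + A(w + G)` along `w = ∫ v`, where `γ = ∂ₜ²G`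
is the second time derivative of the lift `G` of the boundary data. -/
noncomputable def source (A' : ℝ → ℝ) (γ v : ℝ → ℝ → ℝ) (x t : ℝ) : ℝ :=
  γ x t + A' (prim v x t + prim (prim γ) x t) * (v x t + prim γ x t)

theorem continuous_source {A' : ℝ → ℝ} {γ v : ℝ → ℝ → ℝ} (hA' : Continuous A')
    (hγ : Continuous (Function.uncurry γ)) (hv : Continuous (Function.uncurry v)) :
    Continuous (Function.uncurry (source A' γ v)) :=
  hγ.add ((hA'.comp ((continuous_prim hv).add (continuous_prim (continuous_prim hγ)))).mul
    (hv.add (continuous_prim hγ)))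

theorem prim_source {A A' : ℝ → ℝ} {γ v : ℝ → ℝ → ℝ} (hA : ∀ x, HasDerivAt A (A' x) x)
    (hA' : Continuous A') (h0 : A 0 = 0)
    (hγ : Continuous (Function.uncurry γ)) (hv : Continuous (Function.uncurry v)) (x t : ℝ) :
    prim (source A' γ v) x t = prim γ x t + A (prim v x t + prim (prim γ) x t) := by
  refine (eq_prim_of_hasDerivAt (f := fun x t => prim γ x t + A (prim v x t + prim (prim γ) x t))
    (continuous_source hA' hγ hv) (by simp [h0]) (fun s => ?_) t).symm
  exact (hasDerivAt_prim hγ x s).add ((hA _).comp s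
    ((hasDerivAt_prim hv x s).add (hasDerivAt_prim (continuous_prim hγ) x s)))

/-- `v` is the time derivative of the solution `w` of the semilinear problem
`∂ₜq + ∂ₓw = 0`, `∂ₜw + ∂ₓq + ∂ₜG + A(w + G) = 0` with homogeneous boundary and initial values. -/
structure IsVelocity (T : ℝ) (A' : ℝ → ℝ) (γ v : ℝ → ℝ → ℝ) : Prop where
  continuous : Continuous (Function.uncurry v)
  eq : ∀ x ∈ Icc (0 : ℝ) 1, ∀ t ∈ Icc 0 T, v x t = -oddPart (source A' γ v) x t

/-- Truncation at the levels `-M` and `M`. -/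
def clamp (M x : ℝ) : ℝ := max (-M) (min M x)

theorem continuous_clamp (M : ℝ) : Continuous (clamp M) := by unfold clamp; fun_prop

theorem abs_clamp_le {M : ℝ} (hM : 0 ≤ M) (x : ℝ) : |clamp M x| ≤ M :=
  abs_le.2 ⟨le_max_left _ _, max_le (by linarith) (min_le_left _ _)⟩

theorem clamp_of_abs_le {M x : ℝ} (h : |x| ≤ M) : clamp M x = x := by
  rw [clamp, min_eq_right (abs_le.1 h).2, max_eq_right (abs_le.1 h).1]

theorem abs_clamp_sub_le (M x y : ℝ) : |clamp M x - clamp M y| ≤ |x - y| := by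
  refine (abs_max_sub_max_le_max _ _ _ _).trans (max_le (by simp) ?_)
  exact (abs_min_sub_min_le_max _ _ _ _).trans (max_le (by simp) le_rfl)

theorem abs_clamp_le_abs {M : ℝ} (hM : 0 ≤ M) (x : ℝ) : |clamp M x| ≤ |x| := by
  have := abs_clamp_sub_le M x 0
  rwa [clamp_of_abs_le (x := 0) (by simpa using hM), sub_zero, sub_zero] at this

/-- A bound for the velocity which depends on the damping law through the bound for its derivative
only. -/
noncomputable def velocityBound (T a₁ Γ : ℝ) : ℝ :=
  2 * (Γ * (1 + a₁ * T) * T) * Real.exp (2 * a₁ * T)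

theorem abs_velocity_le {T a₁ Γ : ℝ} (hT : 0 ≤ T) (ha₁ : 0 < a₁) {γ v k : ℝ → ℝ → ℝ}
    (hΓ : ∀ x ∈ Icc (0 : ℝ) 1, ∀ t ∈ Icc 0 T, |γ x t| ≤ Γ)
    (hv : Continuous (Function.uncurry v))
    (hk : ∀ x ∈ Icc (0 : ℝ) 1, ∀ t ∈ Icc 0 T, |k x t| ≤ |γ x t| + a₁ * (|v x t| + |prim γ x t|))
    (e : ∀ x ∈ Icc (0 : ℝ) 1, ∀ t ∈ Icc 0 T, v x t = -oddPart k x t) :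
    ∀ x ∈ Icc (0 : ℝ) 1, ∀ t ∈ Icc 0 T, |v x t| ≤ velocityBound T a₁ Γ := by
  have hΓ0 : 0 ≤ Γ := (abs_nonneg _).trans (hΓ 0 (by simp) 0 (by simp [hT]))
  have hpγ : ∀ x ∈ Icc (0 : ℝ) 1, ∀ t ∈ Icc 0 T, |prim γ x t| ≤ Γ * T := fun x hx t ht =>
    (abs_prim_le ht.1 fun τ hτ => hΓ x hx τ ⟨hτ.1, hτ.2.trans ht.2⟩).trans
      (mul_le_mul_of_nonneg_left ht.2 hΓ0)
  have key := abs_le_of_weighted (C := Γ * (1 + a₁ * T) * T) (μ := 2 * a₁) hT hv ?_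
  · intro x hx t ht
    refine (key x hx t ht).trans ?_
    refine mul_le_mul_of_nonneg_left (Real.exp_le_exp.2 ?_) (by positivity)
    exact mul_le_mul_of_nonneg_left ht.2 (by positivity)
  · intro D hD h x hx t ht
    rw [e x hx t ht, abs_neg]
    have h1 := abs_oddPart_le (k := k) (C := Γ * (1 + a₁ * T)) (D := a₁ * D) (μ := 2 * a₁)
      (by positivity) (by positivity) ht.1 (fun y hy τ hτ => by
        have hτ' : τ ∈ Icc 0 T := ⟨hτ.1, hτ.2.trans ht.2⟩
        have b1 := hΓ y hy τ hτ'
        have b2 := mul_le_mul_of_nonneg_left (hpγ y hy τ hτ') ha₁.le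
        have b3 := mul_le_mul_of_nonneg_left (h y hy τ hτ') ha₁.le
        have b4 := hk y hy τ hτ'
        nlinarith) x
    refine h1.trans ?_
    rw [show a₁ * D / (2 * a₁) = D / 2 by field_simp, add_mul]
    refine add_le_add ?_ le_rfl
    have h2 : 1 ≤ Real.exp (2 * a₁ * t) := Real.one_le_exp (mul_nonneg (by positivity) ht.1)
    calc Γ * (1 + a₁ * T) * t ≤ Γ * (1 + a₁ * T) * T :=
          mul_le_mul_of_nonneg_left ht.2 (by positivity)
      _ ≤ _ := le_mul_of_one_le_right (by positivity) h2

theorem exists_isVelocity {T a₁ a₂ : ℝ} (hT : 0 ≤ T) (ha₁ : 0 < a₁) (ha₂ : 0 ≤ a₂) {A' : ℝ → ℝ}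
    {γ : ℝ → ℝ → ℝ} (hA' : ∀ x, |A' x| ≤ a₁) (hlip : ∀ x y, |A' x - A' y| ≤ a₂ * |x - y|)
    (hγ : Continuous (Function.uncurry γ)) : ∃ v, IsVelocity T A' γ v := by
  obtain ⟨Γ, hΓ'⟩ := exists_bound_of_continuous hγ T
  have hΓ : ∀ x ∈ Icc (0 : ℝ) 1, ∀ t ∈ Icc 0 T, |γ x t| ≤ Γ := fun x hx t ht => by
    have := hΓ' x t (abs_le.2 ⟨by linarith [ht.1], ht.2⟩)
    rwa [fold_of_mem hx] at this
  have hΓ0 : 0 ≤ Γ := (abs_nonneg _).trans (hΓ 0 (by simp) 0 (by simp [hT]))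
  have hpγ : ∀ x ∈ Icc (0 : ℝ) 1, ∀ t ∈ Icc 0 T, |prim γ x t| ≤ Γ * T := fun x hx t ht =>
    (abs_prim_le ht.1 fun τ hτ => hΓ x hx τ ⟨hτ.1, hτ.2.trans ht.2⟩).trans
      (mul_le_mul_of_nonneg_left ht.2 hΓ0)
  set M : ℝ := velocityBound T a₁ Γ + Γ * T with hM
  have hM0 : 0 ≤ M := by
    have : 0 ≤ velocityBound T a₁ Γ := by unfold velocityBound; positivity
    positivity
  have cA' : Continuous A' := (LipschitzWith.of_dist_le' (K := a₂) (fun x y => by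
    rw [Real.dist_eq, Real.dist_eq]; exact hlip x y)).continuous
  let ext : C(Icc (0 : ℝ) 1 × Icc (0 : ℝ) T, ℝ) → ℝ → ℝ → ℝ := fun y x t =>
    y (projIcc 0 1 zero_le_one x, projIcc 0 T hT t)
  have hext : ∀ y, Continuous (Function.uncurry (ext y)) := fun y =>
    y.continuous.comp ((continuous_projIcc.comp continuous_fst).prodMk
      (continuous_projIcc.comp continuous_snd))
  have hext_of : ∀ y (q : Icc (0 : ℝ) 1 × Icc (0 : ℝ) T), ext y q.1 q.2 = y q := fun y q => by
    simp [ext, projIcc_val]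
  let src : (ℝ → ℝ → ℝ) → ℝ → ℝ → ℝ := fun v x t =>
    γ x t + A' (prim v x t + prim (prim γ) x t) * clamp M (v x t + prim γ x t)
  have hsrc : ∀ {v}, Continuous (Function.uncurry v) → Continuous (Function.uncurry (src v)) :=
    fun {v} hv => hγ.add ((cA'.comp ((continuous_prim hv).add
      (continuous_prim (continuous_prim hγ)))).mul
      ((continuous_clamp M).comp (hv.add (continuous_prim hγ))))
  let S : C(Icc (0 : ℝ) 1 × Icc (0 : ℝ) T, ℝ) → C(Icc (0 : ℝ) 1 × Icc (0 : ℝ) T, ℝ) := fun y =>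
    ⟨fun q => -oddPart (src (ext y)) q.1 q.2,
      ((continuous_oddPart (hsrc (hext y))).comp (by fun_prop :
        Continuous fun q : Icc (0 : ℝ) 1 × Icc (0 : ℝ) T => ((q.1 : ℝ), (q.2 : ℝ)))).neg⟩
  set B : ℝ := a₁ + M * a₂ * T with hB
  have hB0 : 0 < B := by positivity
  obtain ⟨y, hy⟩ := exists_fixedPoint_of_weighted (μ := 2 * B) S (by
    intro y₁ y₂ D hD h q
    have hv : ∀ x ∈ Icc (0 : ℝ) 1, ∀ t ∈ Icc 0 T,
        |ext y₁ x t - ext y₂ x t| ≤ D * Real.exp (2 * B * t) := fun x hx t ht => by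
      have := h (⟨x, hx⟩, ⟨t, ht⟩)
      rwa [← hext_of y₁, ← hext_of y₂] at this
    have e1 : S y₁ q - S y₂ q =
        -oddPart (fun y τ => src (ext y₁) y τ - src (ext y₂) y τ) q.1 q.2 := by
      rw [oddPart_sub (hsrc (hext y₁)) (hsrc (hext y₂))]
      change -oddPart (src (ext y₁)) q.1 q.2 - -oddPart (src (ext y₂)) q.1 q.2 = _
      ring
    rw [e1, abs_neg]
    have h1 := abs_oddPart_le (k := fun y τ => src (ext y₁) y τ - src (ext y₂) y τ) (C := 0)
      (D := B * D) (μ := 2 * B) (by positivity) (by positivity) q.2.2.1 (fun x hx t ht => by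
        have ht' : t ∈ Icc 0 T := ⟨ht.1, ht.2.trans q.2.2.2⟩
        set E := Real.exp (2 * B * t) with hE
        have b1 := hv x hx t ht'
        have b2 : |prim (ext y₁) x t - prim (ext y₂) x t| ≤ D * E * T := by
          rw [← prim_sub (hext y₁) (hext y₂)]
          refine (abs_prim_le (C := D * E) ht.1 fun τ hτ => (hv x hx τ
            ⟨hτ.1, hτ.2.trans ht'.2⟩).trans ?_).trans
              (mul_le_mul_of_nonneg_left ht'.2 (by positivity))
          refine mul_le_mul_of_nonneg_left (Real.exp_le_exp.2 ?_) hD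
          exact mul_le_mul_of_nonneg_left hτ.2 (by positivity)
        set ξ₁ := prim (ext y₁) x t + prim (prim γ) x t
        set ξ₂ := prim (ext y₂) x t + prim (prim γ) x t
        set η₁ := ext y₁ x t + prim γ x t
        set η₂ := ext y₂ x t + prim γ x t
        have c1 : |A' ξ₁ - A' ξ₂| ≤ a₂ * (D * E * T) := by
          refine (hlip _ _).trans (mul_le_mul_of_nonneg_left ?_ ha₂)
          simpa [ξ₁, ξ₂] using b2
        have c2 : |clamp M η₁ - clamp M η₂| ≤ D * E := by
          refine (abs_clamp_sub_le M _ _).trans ?_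
          simpa [η₁, η₂] using b1
        have e2 : src (ext y₁) x t - src (ext y₂) x t =
            A' ξ₁ * (clamp M η₁ - clamp M η₂) + (A' ξ₁ - A' ξ₂) * clamp M η₂ := by
          simp only [src]
          ring
        rw [e2, zero_add]
        refine (abs_add_le _ _).trans ?_
        rw [abs_mul, abs_mul]
        calc _ ≤ a₁ * (D * E) + a₂ * (D * E * T) * M :=
              add_le_add (mul_le_mul (hA' _) c2 (abs_nonneg _) ha₁.le)
                (mul_le_mul c1 (abs_clamp_le hM0 _) (abs_nonneg _) (by positivity))
          _ = _ := by rw [hB]; ring) q.1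
    refine h1.trans_eq ?_
    field_simp
    ring)
  have hfix : ∀ x ∈ Icc (0 : ℝ) 1, ∀ t ∈ Icc 0 T, ext y x t = -oddPart (src (ext y)) x t := by
    intro x hx t ht
    have := congrArg (fun f => f (⟨x, hx⟩, ⟨t, ht⟩)) hy
    rw [← hext_of y] at this
    exact this.symm
  have hbd := abs_velocity_le hT ha₁ hΓ (hext y) (fun x _ t _ => by
    refine (abs_add_le _ _).trans (add_le_add le_rfl ?_)
    rw [abs_mul]
    exact mul_le_mul (hA' _) ((abs_clamp_le_abs hM0 _).trans (abs_add_le _ _)) (abs_nonneg _)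
      ha₁.le) hfix
  have hsrc_eq : ∀ x ∈ Icc (0 : ℝ) 1, ∀ t ∈ Icc 0 T,
      src (ext y) x t = source A' γ (ext y) x t := by
    intro x hx t ht
    simp only [src, source]
    rw [clamp_of_abs_le]
    exact (abs_add_le _ _).trans (add_le_add (hbd x hx t ht) (hpγ x hx t ht))
  refine ⟨ext y, hext y, fun x hx t ht => (hfix x hx t ht).trans ?_⟩
  have hd : ∀ x, duhamel (src (ext y)) x t = duhamel (source A' γ (ext y)) x t := by
    intro x
    refine intervalIntegral.integral_congr fun σ hσ => ?_
    rw [uIcc_of_le ht.1] at hσ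
    rw [hsrc_eq _ (fold_mem _) _ ⟨by linarith [hσ.2], by linarith [hσ.1, ht.2]⟩]
  rw [oddPart, oddPart, hd, hd]

/-! ### Existence of classical solutions -/

/-- The slices `f(·, t)` of a continuous function of two variables. -/
def slice (f : ℝ → ℝ → ℝ) (hf : Continuous (Function.uncurry f)) : C(ℝ, C(Icc (0 : ℝ) 1, ℝ)) :=
  ContinuousMap.curry ⟨fun z : ℝ × Icc (0 : ℝ) 1 => f z.2 z.1,
    hf.comp (by fun_prop : Continuous fun z : ℝ × Icc (0 : ℝ) 1 => ((z.2 : ℝ), z.1))⟩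

theorem IccExtend_slice {f : ℝ → ℝ → ℝ} (hf : Continuous (Function.uncurry f)) (t : ℝ) {x : ℝ}
    (hx : x ∈ Icc (0 : ℝ) 1) : IccExtend zero_le_one (slice f hf t) x = f x t := by
  rw [IccExtend_of_mem _ _ hx]
  rfl

theorem hasDerivAt_IccExtend_slice {f fx : ℝ → ℝ → ℝ} (hf : Continuous (Function.uncurry f))
    (hfx : Continuous (Function.uncurry fx)) {t : ℝ}
    (h : ∀ x ∈ Ioo (0 : ℝ) 1, HasDerivAt (fun x => f x t) (fx x t) x) :
    ∀ x ∈ Ioo (0 : ℝ) 1, HasDerivAt (IccExtend zero_le_one (slice f hf t))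
      (IccExtend zero_le_one (slice fx hfx t) x) x := by
  intro x hx
  rw [IccExtend_slice hfx t (Ioo_subset_Icc_self hx)]
  refine (h x hx).congr_of_eventuallyEq ?_
  filter_upwards [isOpen_Ioo.mem_nhds hx] with y hy
  exact IccExtend_slice hf t (Ioo_subset_Icc_self hy)

theorem slice_integral {f ft : ℝ → ℝ → ℝ} (hf : Continuous (Function.uncurry f))
    (hft : Continuous (Function.uncurry ft)) {t : ℝ}
    (h : ∀ x ∈ Icc (0 : ℝ) 1, f x t = f x 0 + prim ft x t) :
    slice f hf t = slice f hf 0 + ∫ τ in 0..t, slice ft hft τ := by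
  ext x
  have e := (ContinuousMap.evalCLM ℝ x).intervalIntegral_comp_comm
    ((slice ft hft).continuous.intervalIntegrable (μ := volume) 0 t)
  rw [ContinuousMap.add_apply]
  change _ = _ + (ContinuousMap.evalCLM ℝ x) (∫ τ in 0..t, slice ft hft τ)
  rw [← e]
  exact h x x.2

/-- A differentiable path in `L²` with values in `H¹`, given by a function of two variables. -/
theorem exists_path {T : ℝ} (hT : 0 < T) {f fx ft : ℝ → ℝ → ℝ}
    (hf : Continuous (Function.uncurry f)) (hfx : Continuous (Function.uncurry fx))
    (hft : Continuous (Function.uncurry ft))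
    (hx : ∀ t ∈ Icc 0 T, ∀ x ∈ Ioo (0 : ℝ) 1, HasDerivAt (fun x => f x t) (fx x t) x)
    (ht : ∀ t ∈ Icc 0 T, ∀ x ∈ Icc (0 : ℝ) 1, f x t = f x 0 + prim ft x t) :
    ∃ s : ℝ → Sob 1 0 1, ContinuousOn s (Icc 0 T) ∧ ContDiffOn ℝ 1 (fun t => fn (s t)) (Icc 0 T) ∧
      ∀ t ∈ Icc 0 T,
        (∀ᵐ x ∂volume.restrict (Ioo (0 : ℝ) 1),
          fn (s t) x = f x t ∧ dx (s t) x = fx x t ∧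
            derivWithin (fun t => fn (s t)) (Icc 0 T) t x = ft x t) ∧
        ∀ x ∈ Icc (0 : ℝ) 1, rep (s t) x = f x t := by
  let π : ℝ → ℝ := fun t => projIcc 0 T hT.le t
  have hπ : Continuous π := continuous_subtype_val.comp continuous_projIcc
  have hπm : ∀ t, π t ∈ Icc 0 T := fun t => (projIcc 0 T hT.le t).2
  have hπe : ∀ t ∈ Icc 0 T, π t = t := fun t h => by
    simp only [π, projIcc_of_mem hT.le h]
  let s : ℝ → Sob 1 0 1 := fun t => mkSob1 one_pos (slice f hf (π t)) (slice fx hfx (π t))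
    (hasDerivAt_IccExtend_slice hf hfx (hx _ (hπm t)))
  have hfn : ∀ t, fn (s t) = ofCont zero_le_one (slice f hf (π t)) := fun _ => rfl
  have hdx : ∀ t, dx (s t) = ofCont zero_le_one (slice fx hfx (π t)) := fun _ => rfl
  let Φ : ℝ → L2 0 1 := fun t =>
    ofCont zero_le_one (slice f hf 0 + ∫ τ in 0..t, slice ft hft τ)
  have hΦ : ∀ t, HasDerivAt Φ (ofCont zero_le_one (slice ft hft t)) t := fun t => by
    have h1 : HasDerivAt (fun t => slice f hf 0 + ∫ τ in 0..t, slice ft hft τ) (slice ft hft t) t :=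
      (intervalIntegral.integral_hasDerivAt_right
        ((slice ft hft).continuous.intervalIntegrable _ _)
        (slice ft hft).continuous.stronglyMeasurable.stronglyMeasurableAtFilter
        (slice ft hft).continuous.continuousAt).const_add _
    exact (ofCont zero_le_one).hasFDerivAt.comp_hasDerivAt t h1
  have hΦe : EqOn (fun t => fn (s t)) Φ (Icc 0 T) := fun t h => by
    simp only [hfn, hπe t h, Φ]
    rw [slice_integral hf hft (ht t h)]
  have hΦ1 : ContDiff ℝ 1 Φ := by
    rw [contDiff_one_iff_deriv]
    refine ⟨fun t => (hΦ t).differentiableAt, ?_⟩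
    rw [show deriv Φ = fun t => ofCont zero_le_one (slice ft hft t) from
      funext fun t => (hΦ t).deriv]
    exact (ofCont zero_le_one).continuous.comp (slice ft hft).continuous
  refine ⟨s, ?_, hΦ1.contDiffOn.congr hΦe, fun t h => ⟨?_, fun x hx' => ?_⟩⟩
  · refine Sob.continuousOn_of_fn_dx s ?_ ?_
    · exact ((ofCont zero_le_one).continuous.comp
        ((slice f hf).continuous.comp hπ)).continuousOn
    · exact ((ofCont zero_le_one).continuous.comp
        ((slice fx hfx).continuous.comp hπ)).continuousOn
  · have hd : derivWithin (fun t => fn (s t)) (Icc 0 T) t =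
        ofCont zero_le_one (slice ft hft t) := by
      rw [derivWithin_congr hΦe (hΦe h)]
      exact (hΦ t).hasDerivWithinAt.derivWithin (uniqueDiffOn_Icc hT t h)
    rw [hd, hfn, hdx, hπe t h]
    filter_upwards [ofCont_ae_eq zero_le_one (slice f hf t),
      ofCont_ae_eq zero_le_one (slice fx hfx t), ofCont_ae_eq zero_le_one (slice ft hft t),
      ae_restrict_mem measurableSet_Ioo] with x h1 h2 h3 hm
    have hm' := Ioo_subset_Icc_self hm
    rw [h1, h2, h3, IccExtend_slice hf t hm', IccExtend_slice hfx t hm', IccExtend_slice hft t hm']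
    exact ⟨rfl, rfl, rfl⟩
  · rw [rep_mkSob1 one_pos _ _ _ hx', hπe t h, IccExtend_slice hf t hx']

/-- The affine interpolation between functions given at `x = 0` and `x = 1`. -/
def affine (a b : ℝ → ℝ) (x t : ℝ) : ℝ := (1 - x) * a t + x * b t

theorem continuous_affine {a b : ℝ → ℝ} (ha : Continuous a) (hb : Continuous b) :
    Continuous (Function.uncurry (affine a b)) :=
  (((continuous_const.sub continuous_fst).mul (ha.comp continuous_snd))).add
    (continuous_fst.mul (hb.comp continuous_snd))

theorem prim_affine {a b : ℝ → ℝ} (ha : Continuous a) (hb : Continuous b) :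
    prim (affine a b) = affine (fun t => ∫ τ in 0..t, a τ) (fun t => ∫ τ in 0..t, b τ) := by
  funext x t
  simp only [prim, affine]
  rw [intervalIntegral.integral_add, intervalIntegral.integral_const_mul,
    intervalIntegral.integral_const_mul]
  · exact (ha.const_mul _).intervalIntegrable _ _
  · exact (hb.const_mul _).intervalIntegrable _ _

theorem continuous_integral {a : ℝ → ℝ} (ha : Continuous a) :
    Continuous fun t => ∫ τ in 0..t, a τ :=
  intervalIntegral.continuous_primitive (fun _ _ => ha.intervalIntegrable _ _) 0

theorem eq_integral_derivWithin {T : ℝ} (hT : 0 < T) {g : ℝ → ℝ} (hg : ContDiffOn ℝ 1 g (Icc 0 T))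
    (h0 : g 0 = 0) {t : ℝ} (ht : t ∈ Icc 0 T) :
    g t = ∫ τ in 0..t, derivWithin g (Icc 0 T) τ := by
  have hc := hg.continuousOn_derivWithin (uniqueDiffOn_Icc hT) le_rfl
  rw [intervalIntegral.integral_eq_sub_of_hasDerivAt_of_le ht.1
    (hg.continuousOn.mono (Icc_subset_Icc_right ht.2)) (fun τ hτ => ?_), h0, sub_zero]
  · exact (hc.mono (by rw [uIcc_of_le ht.1]; exact Icc_subset_Icc_right ht.2)).intervalIntegrable
  · have hτ' : τ ∈ Ioo 0 T := ⟨hτ.1, hτ.2.trans_le ht.2⟩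
    exact ((hg.differentiableOn one_ne_zero τ (Ioo_subset_Icc_self hτ')).hasDerivWithinAt).hasDerivAt
      (Icc_mem_nhds hτ'.1 hτ'.2)

theorem exists_second_primitive {T : ℝ} (hT : 0 < T) {g : ℝ → ℝ}
    (hg : ContDiffOn ℝ 4 g (Icc 0 T)) (h0 : g 0 = 0) (h1 : derivWithin g (Icc 0 T) 0 = 0) :
    ∃ γ : ℝ → ℝ, Continuous γ ∧ ∀ t ∈ Icc 0 T, g t = ∫ s in 0..t, ∫ τ in 0..s, γ τ := by
  have hu := uniqueDiffOn_Icc hT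
  have hg1 : ContDiffOn ℝ 1 (derivWithin g (Icc 0 T)) (Icc 0 T) :=
    hg.derivWithin hu (by norm_num)
  have hc := hg1.continuousOn_derivWithin hu le_rfl
  set g2 := derivWithin (derivWithin g (Icc 0 T)) (Icc 0 T) with hg2
  refine ⟨IccExtend hT.le ((Icc 0 T).domRestrict g2), hc.domRestrict.Icc_extend', fun t ht => ?_⟩
  rw [eq_integral_derivWithin hT (hg.of_le (by norm_num)) h0 ht]
  refine intervalIntegral.integral_congr fun s hs => ?_
  rw [uIcc_of_le ht.1] at hs
  have hs' : s ∈ Icc 0 T := ⟨hs.1, hs.2.trans ht.2⟩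
  rw [eq_integral_derivWithin hT hg1 h1 hs']
  refine intervalIntegral.integral_congr fun τ hτ => ?_
  rw [uIcc_of_le hs.1] at hτ
  have hτ' : τ ∈ Icc 0 T := ⟨hτ.1, hτ.2.trans hs'.2⟩
  rw [IccExtend_of_mem _ _ hτ']
  rfl

theorem IsVelocity.prim_eq {T : ℝ} {A' : ℝ → ℝ} {γ v : ℝ → ℝ → ℝ} (hv : IsVelocity T A' γ v)
    (hA' : Continuous A') (hγ : Continuous (Function.uncurry γ)) :
    ∀ t ∈ Icc 0 T, ∀ x ∈ Icc (0 : ℝ) 1, prim v x t = -oddPart (prim (source A' γ v)) x t := by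
  intro t ht x hx
  rw [oddPart_prim (continuous_source hA' hγ hv.continuous) ht.1, prim, prim,
    ← intervalIntegral.integral_neg]
  refine intervalIntegral.integral_congr fun τ hτ => ?_
  rw [uIcc_of_le ht.1] at hτ
  exact hv.eq x hx τ ⟨hτ.1, hτ.2.trans ht.2⟩

/-- The classical solution given by the velocity `v`. -/
theorem IsVelocity.exists_isClassicalSolution {T c : ℝ} (hT : 0 < T) {A A' : ℝ → ℝ}
    (hA : ∀ x, HasDerivAt A (A' x) x) (hA' : Continuous A') (hA0 : A 0 = 0)
    {p₀ u₀ g₀ g₁ γ₀ γ₁ : ℝ → ℝ} (hp₀ : ∀ x ∈ Ioo (0 : ℝ) 1, p₀ x = c)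
    (hu₀ : ∀ x ∈ Ioo (0 : ℝ) 1, u₀ x = 0) (hγ₀ : Continuous γ₀) (hγ₁ : Continuous γ₁)
    (hg₀ : ∀ t ∈ Icc 0 T, g₀ t = ∫ s in 0..t, ∫ τ in 0..s, γ₀ τ)
    (hg₁ : ∀ t ∈ Icc 0 T, g₁ t = ∫ s in 0..t, ∫ τ in 0..s, γ₁ τ) {v : ℝ → ℝ → ℝ}
    (hv : IsVelocity T A' (affine γ₀ γ₁) v) :
    ∃ p u : ℝ → Sob 1 0 1, IsClassicalSolution T p₀ u₀ g₀ g₁ A p u ∧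
      ∀ t ∈ Icc 0 T, (∀ x ∈ Icc (0 : ℝ) 1,
        rep (u t) x = prim v x t + prim (prim (affine γ₀ γ₁)) x t) ∧
        rep (p t) 0 - rep (p t) 1 = evenPart (prim (source A' (affine γ₀ γ₁) v)) 1 t -
          evenPart (prim (source A' (affine γ₀ γ₁) v)) 0 t := by
  set γ := affine γ₀ γ₁ with hγdef
  have hγ : Continuous (Function.uncurry γ) := continuous_affine hγ₀ hγ₁
  set k := source A' γ v with hk
  have ck : Continuous (Function.uncurry k) := continuous_source hA' hγ hv.continuous
  have cv := hv.continuous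
  set G₀ : ℝ → ℝ := fun t => ∫ s in 0..t, ∫ τ in 0..s, γ₀ τ with hG₀
  set G₁ : ℝ → ℝ := fun t => ∫ s in 0..t, ∫ τ in 0..s, γ₁ τ with hG₁
  have cG₀ : Continuous G₀ := continuous_integral (continuous_integral hγ₀)
  have cG₁ : Continuous G₁ := continuous_integral (continuous_integral hγ₁)
  have hG : prim (prim γ) = affine G₀ G₁ := by
    rw [hγdef, prim_affine hγ₀ hγ₁,
      prim_affine (continuous_integral hγ₀) (continuous_integral hγ₁)]
  have pv := hv.prim_eq hA' hγ
  rw [← hk] at pv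
  have hb : Continuous fun t => G₁ t - G₀ t := cG₁.sub cG₀
  have cu : Continuous (Function.uncurry fun x t => prim v x t + prim (prim γ) x t) :=
    (continuous_prim cv).add (continuous_prim (continuous_prim hγ))
  have cux : Continuous (Function.uncurry fun x t => G₁ t - G₀ t + evenPart k x t) :=
    (hb.comp continuous_snd).add (continuous_evenPart ck)
  have cut : Continuous (Function.uncurry fun x t => v x t + prim γ x t) :=
    cv.add (continuous_prim hγ)
  have cp : Continuous (Function.uncurry fun x t =>
      c - (∫ τ in 0..t, (G₁ τ - G₀ τ)) - evenPart (prim k) x t) :=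
    (continuous_const.sub ((continuous_integral hb).comp continuous_snd)).sub
      (continuous_evenPart (continuous_prim ck))
  have cpx : Continuous (Function.uncurry fun x t => -(prim k x t - oddPart k x t)) :=
    ((continuous_prim ck).sub (continuous_oddPart ck)).neg
  have cpt : Continuous (Function.uncurry fun x t => -(G₁ t - G₀ t) - evenPart k x t) :=
    (hb.comp continuous_snd).neg.sub (continuous_evenPart ck)
  obtain ⟨u, u1, u2, u3⟩ := exists_path hT cu cux cut (fun t ht x hx => by
      have e1 : HasDerivAt (fun x => prim v x t) (evenPart k x t) x := by
        rw [← neg_neg (evenPart k x t)]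
        refine (hasDerivAt_oddPart ck ht.1 hx).neg.congr_of_eventuallyEq ?_
        filter_upwards [isOpen_Ioo.mem_nhds hx] with y hy
        exact pv t ht y (Ioo_subset_Icc_self hy)
      have e2 : HasDerivAt (fun x => prim (prim γ) x t) (G₁ t - G₀ t) x := by
        simp only [hG, affine]
        convert! (((hasDerivAt_id x).const_sub 1).mul_const (G₀ t)).add
          ((hasDerivAt_id x).mul_const (G₁ t)) using 1
        ring
      rw [add_comm]
      exact e1.add e2) (fun t ht x hx => by
      rw [prim_zero, prim_zero, zero_add, zero_add]
      exact (intervalIntegral.integral_add (intervalIntegrable_right cv _ _ _)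
        (intervalIntegrable_right (continuous_prim hγ) _ _ _)).symm)
  obtain ⟨p, p1, p2, p3⟩ := exists_path hT cp cpx cpt (fun t ht x hx => by
      exact (hasDerivAt_evenPart ck ht.1 hx).const_sub _) (fun t ht x hx => by
      rw [evenPart_prim ck ht.1, evenPart_prim ck le_rfl]
      simp only [prim, intervalIntegral.integral_same, sub_zero]
      rw [intervalIntegral.integral_sub (f := fun τ => -(G₁ τ - G₀ τ)) (g := evenPart k x)
        ((show Continuous fun τ => -(G₁ τ - G₀ τ) from hb.neg).intervalIntegrable _ _)
        (intervalIntegrable_right (continuous_evenPart ck) _ _ _), intervalIntegral.integral_neg]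
      ring)
  have h0T : (0 : ℝ) ∈ Icc 0 T := by simp [hT.le]
  refine ⟨p, u, ⟨p1, u1, p2, u2, fun t ht => ?_, fun t ht => ?_, fun t ht => ?_, ?_⟩, fun t ht =>
    ⟨(u3 t ht).2, ?_⟩⟩
  · filter_upwards [(u3 t ht).1, (p3 t ht).1] with x hu hp
    rw [hp.2.2, hu.2.1]
    ring
  · filter_upwards [(u3 t ht).1, (p3 t ht).1, ae_restrict_mem measurableSet_Ioo] with x hu hp hx
    rw [hu.2.2, hp.2.1, hu.1, hk, prim_source hA hA' hA0 hγ cv, ← hk,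
      hv.eq x (Ioo_subset_Icc_self hx) t ht]
    ring
  · rw [(u3 t ht).2 0 (by simp), (u3 t ht).2 1 (by simp), pv t ht 0 (by simp),
      pv t ht 1 (by simp), oddPart_zero, oddPart_one, hG, hg₀ t ht, hg₁ t ht]
    simp [affine, hG₀, hG₁]
  · filter_upwards [(u3 0 h0T).1, (p3 0 h0T).1, ae_restrict_mem measurableSet_Ioo] with x hu hp hx
    rw [hu.1, hp.1, hp₀ x hx, hu₀ x hx]
    simp [evenPart, duhamel_zero_right]
  · rw [(p3 t ht).2 0 (by simp), (p3 t ht).2 1 (by simp)]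
    ring

/-! ### Stability of the pressure drop -/

theorem evenPart_sub {k₁ k₂ : ℝ → ℝ → ℝ} (h₁ : Continuous (Function.uncurry k₁))
    (h₂ : Continuous (Function.uncurry k₂)) (x t : ℝ) :
    evenPart (fun y τ => k₁ y τ - k₂ y τ) x t = evenPart k₁ x t - evenPart k₂ x t := by
  simp only [evenPart, duhamel_sub h₁ h₂]
  ring

theorem abs_evenPart_le {k : ℝ → ℝ → ℝ} {C D μ t : ℝ} (hμ : 0 < μ) (hD : 0 ≤ D) (ht : 0 ≤ t)
    (h : ∀ y ∈ Icc (0 : ℝ) 1, ∀ τ ∈ Icc 0 t, |k y τ| ≤ C + D * Real.exp (μ * τ)) (x : ℝ) :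
    |evenPart k x t| ≤ C * t + D / μ * Real.exp (μ * t) := by
  have h1 := abs_duhamel_le hμ hD ht h x
  have h2 := abs_duhamel_le hμ hD ht h (-x)
  rw [evenPart, abs_div, abs_two, div_le_iff₀ two_pos]
  linarith [abs_add_le (duhamel k x t) (duhamel k (-x) t)]

theorem IsLaw.abs_sub_le {a₀ a₁ a₂ a₃ : ℝ} {A A' A'' : ℝ → ℝ} (h : IsLaw a₀ a₁ a₂ a₃ A A' A'')
    (h0 : 0 ≤ a₀) (x y : ℝ) : |A x - A y| ≤ a₁ * |x - y| := by
  have := Convex.norm_image_sub_le_of_norm_hasDerivWithin_le (C := a₁) (s := univ)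
    (fun z _ => (h.hasDerivAt z).hasDerivWithinAt) (fun z _ => by
      rw [Real.norm_eq_abs, abs_of_nonneg (h0.trans (h.lower z))]
      exact h.upper z) convex_univ (mem_univ y) (mem_univ x)
  exact this

theorem IsLaw.abs_fst_sub_le {a₀ a₁ a₂ a₃ : ℝ} {A A' A'' : ℝ → ℝ}
    (h : IsLaw a₀ a₁ a₂ a₃ A A' A'') (x y : ℝ) : |A' x - A' y| ≤ a₂ * |x - y| :=
  Convex.norm_image_sub_le_of_norm_hasDerivWithin_le (C := a₂) (s := univ)
    (fun z _ => (h.hasDerivAt' z).hasDerivWithinAt) (fun z _ => h.abs_le z)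
    convex_univ (mem_univ y) (mem_univ x)

/-- The pressure drop of the solution given by the velocity `v`. -/
noncomputable def drop (A' : ℝ → ℝ) (γ v : ℝ → ℝ → ℝ) (t : ℝ) : ℝ :=
  evenPart (prim (source A' γ v)) 1 t - evenPart (prim (source A' γ v)) 0 t

theorem continuous_drop {A' : ℝ → ℝ} {γ v : ℝ → ℝ → ℝ} (hA' : Continuous A')
    (hγ : Continuous (Function.uncurry γ)) (hv : Continuous (Function.uncurry v)) :
    Continuous (drop A' γ v) := by
  have h := continuous_prim (continuous_source hA' hγ hv)
  have e : ∀ x : ℝ, Continuous fun t => evenPart (prim (source A' γ v)) x t := fun x =>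
    ((continuous_duhamel_comp h continuous_const continuous_id).add
      (continuous_duhamel_comp h continuous_const continuous_id)).div_const 2
  exact (e 1).sub (e 0)

theorem abs_drop_sub_le {T ε a₀ a₁ a₂ a₃ : ℝ} (hT : 0 ≤ T) (hε : 0 ≤ ε) (ha₀ : 0 < a₀)
    {A A' A'' B B' B'' : ℝ → ℝ} {γ v w : ℝ → ℝ → ℝ} (hA : IsLaw a₀ a₁ a₂ a₃ A A' A'')
    (hB : IsLaw a₀ a₁ a₂ a₃ B B' B'') (hγ : Continuous (Function.uncurry γ))
    (hv : IsVelocity T A' γ v) (hw : IsVelocity T B' γ w)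
    (h : ∀ x ∈ Icc (0 : ℝ) 1, ∀ t ∈ Icc 0 T,
      |A (prim v x t + prim (prim γ) x t) - B (prim v x t + prim (prim γ) x t)| ≤ ε) :
    ∀ t ∈ Icc 0 T, |drop A' γ v t - drop B' γ w t| ≤
      2 * (T + T * Real.exp (2 * a₁ * T)) * ε := by
  have ha₁ : 0 < a₁ := ha₀.trans_le ((hA.lower 0).trans (hA.upper 0))
  have ck := continuous_prim (continuous_source hA.continuous_fst hγ hv.continuous)
  have cl := continuous_prim (continuous_source hB.continuous_fst hγ hw.continuous)
  set k := prim (source A' γ v) with hk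
  set l := prim (source B' γ w) with hl
  have hkl : ∀ x ∈ Icc (0 : ℝ) 1, ∀ t ∈ Icc 0 T,
      |k x t - l x t| ≤ ε + a₁ * |prim v x t - prim w x t| := by
    intro x hx t ht
    rw [hk, hl, prim_source hA.hasDerivAt hA.continuous_fst hA.zero hγ hv.continuous,
      prim_source hB.hasDerivAt hB.continuous_fst hB.zero hγ hw.continuous, add_sub_add_left_eq_sub]
    refine (abs_sub_le _ (B (prim v x t + prim (prim γ) x t)) _).trans
      (add_le_add (h x hx t ht) ?_)
    refine (hB.abs_sub_le ha₀.le _ _).trans_eq ?_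
    rw [add_sub_add_right_eq_sub]
  have key := abs_le_of_weighted (f := fun x t => prim v x t - prim w x t) (C := ε * T)
    (μ := 2 * a₁) hT ((continuous_prim hv.continuous).sub (continuous_prim hw.continuous)) (by
      intro D hD hb x hx t ht
      rw [hv.prim_eq hA.continuous_fst hγ t ht x hx, hw.prim_eq hB.continuous_fst hγ t ht x hx,
        ← hk, ← hl, neg_sub_neg, ← oddPart_sub cl ck]
      have e := abs_oddPart_le (k := fun y τ => l y τ - k y τ) (C := ε) (D := a₁ * D)
        (μ := 2 * a₁) (by positivity) (by positivity) ht.1 (fun y hy τ hτ => by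
          have hτ' : τ ∈ Icc 0 T := ⟨hτ.1, hτ.2.trans ht.2⟩
          rw [abs_sub_comm]
          refine (hkl y hy τ hτ').trans (add_le_add le_rfl ?_)
          rw [mul_assoc]
          exact mul_le_mul_of_nonneg_left (hb y hy τ hτ') ha₁.le) x
      refine e.trans ?_
      rw [show a₁ * D / (2 * a₁) = D / 2 by field_simp, add_mul]
      refine add_le_add ?_ le_rfl
      exact (mul_le_mul_of_nonneg_left ht.2 hε).trans (le_mul_of_one_le_right (by positivity)
        (Real.one_le_exp (mul_nonneg (by positivity) ht.1))))
  intro t ht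
  have he : ∀ x, |evenPart k x t - evenPart l x t| ≤ (T + T * Real.exp (2 * a₁ * T)) * ε := by
    intro x
    rw [← evenPart_sub ck cl]
    have e := abs_evenPart_le (k := fun y τ => k y τ - l y τ) (C := ε) (D := a₁ * (2 * (ε * T)))
      (μ := 2 * a₁) (by positivity) (by positivity) ht.1 (fun y hy τ hτ => by
        have hτ' : τ ∈ Icc 0 T := ⟨hτ.1, hτ.2.trans ht.2⟩
        refine (hkl y hy τ hτ').trans (add_le_add le_rfl ?_)
        rw [mul_assoc]
        exact mul_le_mul_of_nonneg_left (key y hy τ hτ') ha₁.le) x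
    refine e.trans ?_
    rw [show a₁ * (2 * (ε * T)) / (2 * a₁) = ε * T by field_simp]
    have e1 : Real.exp (2 * a₁ * t) ≤ Real.exp (2 * a₁ * T) :=
      Real.exp_le_exp.2 (mul_le_mul_of_nonneg_left ht.2 (by positivity))
    have e2 := mul_le_mul_of_nonneg_left e1 (by positivity : 0 ≤ ε * T)
    have e3 := mul_le_mul_of_nonneg_left ht.2 hε
    linarith
  have e1 := he 1
  have e2 := he 0
  rw [drop, drop, ← hk, ← hl, show evenPart k 1 t - evenPart k 0 t -
    (evenPart l 1 t - evenPart l 0 t) = (evenPart k 1 t - evenPart l 1 t) -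
      (evenPart k 0 t - evenPart l 0 t) by ring]
  refine (abs_sub _ _).trans ?_
  linarith

/-! ### Compactness of the set of damping laws -/

theorem continuous_const_add_primitive {Y : Type*} [TopologicalSpace Y] {b : Y → ℝ}
    {f : Y → ℝ → ℝ} (hb : Continuous b) (hf : Continuous (Function.uncurry f)) :
    Continuous (Function.uncurry fun y x => b y + ∫ s in 0..x, f y s) := by
  have h1 : Continuous (Function.uncurry fun (z : Y × ℝ) (s : ℝ) => f z.1 s) :=
    hf.comp (by fun_prop : Continuous fun w : (Y × ℝ) × ℝ => (w.1.1, w.2))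
  exact (hb.comp continuous_fst).add
    (intervalIntegral.continuous_parametric_intervalIntegral_of_continuous h1 continuous_snd)

/-- Damping laws are parametrized by `A'(0)` and `A''`. -/
abbrev Param : Type := ℝ × C(ℝ, ℝ)

/-- The derivative of the damping law with parameter `y`. -/
noncomputable def law' (y : Param) (x : ℝ) : ℝ := y.1 + ∫ s in 0..x, y.2 s

/-- The damping law with parameter `y`. -/
noncomputable def law (y : Param) (x : ℝ) : ℝ := 0 + ∫ s in 0..x, law' y s

theorem continuous_law'' : Continuous (Function.uncurry fun (y : Param) (x : ℝ) => y.2 x) :=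
  ContinuousEval.continuous_eval.comp
    ((continuous_snd.comp continuous_fst).prodMk continuous_snd)

theorem continuous_law' : Continuous (Function.uncurry law') :=
  continuous_const_add_primitive continuous_fst continuous_law''

theorem continuous_law : Continuous (Function.uncurry law) :=
  continuous_const_add_primitive continuous_const continuous_law'

theorem hasDerivAt_const_add_primitive {f : ℝ → ℝ} (hf : Continuous f) (b x : ℝ) :
    HasDerivAt (fun x => b + ∫ s in 0..x, f s) (f x) x :=
  (intervalIntegral.integral_hasDerivAt_right (hf.intervalIntegrable _ _)
    hf.stronglyMeasurable.stronglyMeasurableAtFilter hf.continuousAt).const_add b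

theorem hasDerivAt_law' (y : Param) (x : ℝ) : HasDerivAt (law' y) (y.2 x) x :=
  hasDerivAt_const_add_primitive y.2.continuous _ _

theorem hasDerivAt_law (y : Param) (x : ℝ) : HasDerivAt (law y) (law' y x) x :=
  hasDerivAt_const_add_primitive
    (continuous_law'.comp (by fun_prop : Continuous fun x : ℝ => (y, x))) _ _

/-- The parameters of the damping laws satisfying (A1). -/
def lawSet (a₀ a₁ a₂ a₃ : ℝ) : Set Param := {y | IsLaw a₀ a₁ a₂ a₃ (law y) (law' y) y.2}

theorem IsLaw.exists_param {a₀ a₁ a₂ a₃ : ℝ} {A A' A'' : ℝ → ℝ}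
    (h : IsLaw a₀ a₁ a₂ a₃ A A' A'') : ∃ y ∈ lawSet a₀ a₁ a₂ a₃, law y = A := by
  let y : Param := (A' 0, ⟨A'', h.continuous_snd⟩)
  have e1 : law' y = A' := by
    funext x
    change A' 0 + ∫ s in 0..x, A'' s = A' x
    rw [intervalIntegral.integral_eq_sub_of_hasDerivAt (fun s _ => h.hasDerivAt' s)
      (h.continuous_snd.intervalIntegrable _ _)]
    ring
  have e0 : law y = A := by
    funext x
    rw [law, e1, intervalIntegral.integral_eq_sub_of_hasDerivAt (fun s _ => h.hasDerivAt s)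
      (h.continuous_fst.intervalIntegrable _ _), h.zero]
    ring
  exact ⟨y, by rw [lawSet, mem_ofPred_eq, e0, e1]; exact h, e0⟩

theorem isCompact_boundedLipschitz {C L : ℝ} :
    IsCompact {e : C(ℝ, ℝ) | (∀ x, |e x| ≤ C) ∧ ∀ x y, |e x - e y| ≤ L * |x - y|} := by
  have hL : ∀ e : C(ℝ, ℝ), (∀ x y, |e x - e y| ≤ L * |x - y|) → LipschitzWith (Real.toNNReal L) e :=
    fun e h => LipschitzWith.of_dist_le' fun x y => by
      rw [Real.dist_eq, Real.dist_eq]; exact h x y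
  refine ArzelaAscoli.isCompact_of_equicontinuous _ ?_ ?_
  · have e : ContinuousMap.toFun '' {e : C(ℝ, ℝ) | (∀ x, |e x| ≤ C) ∧
        ∀ x y, |e x - e y| ≤ L * |x - y|} =
        (univ.pi fun _ => Icc (-C) C) ∩ {f : ℝ → ℝ | ∀ x y, |f x - f y| ≤ L * |x - y|} := by
      ext f
      constructor
      · rintro ⟨e, he, rfl⟩
        exact ⟨fun x _ => abs_le.1 (he.1 x), he.2⟩
      · rintro ⟨h1, h2⟩
        have hc : Continuous f := (LipschitzWith.of_dist_le' (K := L) fun x y => by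
          rw [Real.dist_eq, Real.dist_eq]; exact h2 x y).continuous
        exact ⟨⟨f, hc⟩, ⟨fun x => abs_le.2 (h1 x (mem_univ x)), h2⟩, rfl⟩
    rw [e]
    refine (isCompact_univ_pi fun _ => isCompact_Icc).inter_right ?_
    simp only [ofPred_forall]
    exact isClosed_iInter fun x => isClosed_iInter fun y => isClosed_le (by fun_prop) (by fun_prop)
  · refine (LipschitzWith.uniformEquicontinuous _ (Real.toNNReal L) ?_).equicontinuous
    rintro ⟨e, he⟩
    exact hL e he.2

theorem isCompact_lawSet (a₀ a₁ a₂ a₃ : ℝ) : IsCompact (lawSet a₀ a₁ a₂ a₃) := by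
  have e : lawSet a₀ a₁ a₂ a₃ = (Icc a₀ a₁ ×ˢ
      {e : C(ℝ, ℝ) | (∀ x, |e x| ≤ a₂) ∧ ∀ x y, |e x - e y| ≤ a₃ * |x - y|}) ∩
      {y | ∀ x, law' y x ∈ Icc a₀ a₁} := by
    ext y
    constructor
    · intro (h : IsLaw a₀ a₁ a₂ a₃ (law y) (law' y) y.2)
      have h0 : law' y 0 = y.1 := by simp [law']
      exact ⟨⟨⟨h0 ▸ h.lower 0, h0 ▸ h.upper 0⟩, h.abs_le, h.lipschitz⟩,
        fun x => ⟨h.lower x, h.upper x⟩⟩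
    · rintro ⟨⟨_, h1, h2⟩, h3⟩
      exact ⟨by simp [law], hasDerivAt_law y, hasDerivAt_law' y, fun x => (h3 x).1,
        fun x => (h3 x).2, h1, h2⟩
  rw [e]
  refine (isCompact_Icc.prod isCompact_boundedLipschitz).inter_right ?_
  simp only [ofPred_forall]
  exact isClosed_iInter fun x => isClosed_Icc.preimage
    (continuous_law'.comp (by fun_prop : Continuous fun y : Param => (y, x)))

/-- The restrictions to `[l, r]` of a continuous family of functions. -/
def familyIcc {Y : Type*} [TopologicalSpace Y] (l r : ℝ) (f : Y → ℝ → ℝ)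
    (hf : Continuous (Function.uncurry f)) : C(Y, C(Icc l r, ℝ)) :=
  ContinuousMap.curry ⟨fun z : Y × Icc l r => f z.1 z.2,
    hf.comp (by fun_prop : Continuous fun z : Y × Icc l r => (z.1, (z.2 : ℝ)))⟩

theorem IccExtend_familyIcc {Y : Type*} [TopologicalSpace Y] {l r : ℝ} (h : l ≤ r) {f : Y → ℝ → ℝ}
    (hf : Continuous (Function.uncurry f)) (y : Y) {x : ℝ} (hx : x ∈ Icc l r) :
    IccExtend h (familyIcc l r f hf y) x = f y x := by
  rw [IccExtend_of_mem _ _ hx]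
  rfl

theorem hasDerivAt_IccExtend_familyIcc {Y : Type*} [TopologicalSpace Y] {l r : ℝ} (h : l ≤ r)
    {f f' : Y → ℝ → ℝ} (hf : Continuous (Function.uncurry f))
    (hf' : Continuous (Function.uncurry f')) {y : Y} (hd : ∀ x, HasDerivAt (f y) (f' y x) x) :
    ∀ x ∈ Ioo l r, HasDerivAt (IccExtend h (familyIcc l r f hf y))
      (IccExtend h (familyIcc l r f' hf' y) x) x := by
  intro x hx
  rw [IccExtend_familyIcc h hf' y (Ioo_subset_Icc_self hx)]
  refine (hd x).congr_of_eventuallyEq ?_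
  filter_upwards [isOpen_Ioo.mem_nhds hx] with z hz
  exact IccExtend_familyIcc h hf y (Ioo_subset_Icc_self hz)

/-- The element of `H²(l, r)` given by the damping law with parameter `y`. -/
noncomputable def lawSob {l r : ℝ} (h : l < r) (y : Param) : Sob 2 l r :=
  mkSob2 h (familyIcc l r law continuous_law y) (familyIcc l r law' continuous_law' y)
    (familyIcc l r (fun y : Param => y.2) continuous_law'' y)
    (hasDerivAt_IccExtend_familyIcc h.le continuous_law continuous_law' (hasDerivAt_law y))
    (hasDerivAt_IccExtend_familyIcc h.le continuous_law' continuous_law'' (hasDerivAt_law' y))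

theorem continuous_lawSob {l r : ℝ} (h : l < r) : Continuous (lawSob h) := by
  refine Continuous.subtype_mk ?_ _
  refine (PiLp.continuous_toLp 2 _).comp (continuous_pi fun i => ?_)
  fin_cases i
  · exact (ofCont h.le).continuous.comp (familyIcc l r law continuous_law).continuous
  · exact (ofCont h.le).continuous.comp (familyIcc l r law' continuous_law').continuous
  · exact (ofCont h.le).continuous.comp
      (familyIcc l r (fun y : Param => y.2) continuous_law'').continuous

theorem fn_lawSob_ae_eq {l r : ℝ} (h : l < r) (y : Param) :
    fn (lawSob h y) =ᵐ[volume.restrict (Ioo l r)] law y := by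
  filter_upwards [ofCont_ae_eq h.le (familyIcc l r law continuous_law y),
    ae_restrict_mem measurableSet_Ioo] with x hx hm
  refine hx.trans ?_
  exact IccExtend_familyIcc h.le continuous_law y (Ioo_subset_Icc_self hm)

/-- An element of `H²` is determined by its underlying function. -/
theorem Sob.ext_fn_two {l r : ℝ} {v w : Sob 2 l r} (h : fn v = fn w) : v = w := by
  have key : ∀ {f g f' g' : L2 l r}, f = g → IsWeakDeriv (Ioo l r) f f' →
      IsWeakDeriv (Ioo l r) g g' → f' = g' := by
    rintro f _ f' g' rfl h1 h2
    exact Lp.ext (IsWeakDeriv.ae_unique (L2.integrableOn _) (L2.integrableOn _) h1 h2)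
  have h1 : v.1 1 = w.1 1 := key h (v.2 0) (w.2 0)
  have h2 : v.1 2 = w.1 2 := key h1 (v.2 1) (w.2 1)
  apply Subtype.ext
  apply PiLp.ext
  intro i
  fin_cases i
  · exact h
  · exact h1
  · exact h2

theorem domF_eq_image {a₀ a₁ a₂ a₃ ul uh : ℝ} (h : ul < uh) :
    domF a₀ a₁ a₂ a₃ ul uh = lawSob h '' lawSet a₀ a₁ a₂ a₃ := by
  ext a
  constructor
  · rintro ⟨A, hA, e⟩
    obtain ⟨A', A'', hl⟩ := hA.exists_isLaw
    obtain ⟨y, hy, rfl⟩ := hl.exists_param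
    exact ⟨y, hy, Sob.ext_fn_two (Lp.ext ((fn_lawSob_ae_eq h y).trans e.symm))⟩
  · rintro ⟨y, hy, rfl⟩
    exact ⟨law y, IsLaw.a1 hy, fn_lawSob_ae_eq h y⟩

/-! ### The forward operator -/

theorem IsClassicalSolution.congr_law {T ul uh : ℝ} {p₀ u₀ g₀ g₁ A B : ℝ → ℝ}
    {p u : ℝ → Sob 1 0 1} (h : IsClassicalSolution T p₀ u₀ g₀ g₁ A p u)
    (hr : HasRangeIn T ul uh u) (e : EqOn A B (Icc ul uh)) :
    IsClassicalSolution T p₀ u₀ g₀ g₁ B p u :=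
  { h with
    momentum := fun t ht => by
      filter_upwards [h.momentum t ht, Sob.fn_ae_eq_rep one_pos (u t),
        ae_restrict_mem measurableSet_Ioo] with x h1 h2 hx
      rw [← e, h1]
      rw [h2]
      exact hr t ht x (Ioo_subset_Icc_self hx) }

theorem norm_sub_le_of_continuous {l r C : ℝ} (hC : 0 ≤ C) {f g : L2 l r} {φ ψ : ℝ → ℝ}
    (hf : f =ᵐ[volume.restrict (Ioo l r)] φ) (hg : g =ᵐ[volume.restrict (Ioo l r)] ψ)
    (h : ∀ x ∈ Icc l r, |φ x - ψ x| ≤ C) :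
    ‖f - g‖ ≤ measureUnivNNReal (volume.restrict (Ioo l r)) ^ (2 : ENNReal).toReal⁻¹ * C := by
  refine Lp.norm_le_of_ae_bound hC ?_
  filter_upwards [hf, hg, Lp.coeFn_sub f g, ae_restrict_mem measurableSet_Ioo] with x h1 h2 h3 hx
  rw [h3, Pi.sub_apply, h1, h2]
  exact h x (Ioo_subset_Icc_self hx)

section
variable {a₀ a₁ a₂ a₃ T : ℝ} {p₀ u₀ g₀ g₁ : ℝ → ℝ}

/-- The data of the problem in terms of the second derivatives of the boundary values. -/
structure IsData (T c : ℝ) (p₀ u₀ g₀ g₁ γ₀ γ₁ : ℝ → ℝ) : Prop where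
  pos : 0 < T
  p₀_eq : ∀ x ∈ Ioo (0 : ℝ) 1, p₀ x = c
  u₀_eq : ∀ x ∈ Ioo (0 : ℝ) 1, u₀ x = 0
  continuous₀ : Continuous γ₀
  continuous₁ : Continuous γ₁
  g₀_eq : ∀ t ∈ Icc 0 T, g₀ t = ∫ s in 0..t, ∫ τ in 0..s, γ₀ τ
  g₁_eq : ∀ t ∈ Icc 0 T, g₁ t = ∫ s in 0..t, ∫ τ in 0..s, γ₁ τ

theorem exists_isData (h2 : A2 p₀ u₀) (h3 : A3 T g₀ g₁) :
    ∃ c γ₀ γ₁, IsData T c p₀ u₀ g₀ g₁ γ₀ γ₁ := by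
  obtain ⟨hu, c, hp⟩ := h2
  obtain ⟨hT, c0, c1, z0, z1, d0, d1⟩ := h3
  obtain ⟨γ₀, k0, e0⟩ := exists_second_primitive hT c0 z0 d0
  obtain ⟨γ₁, k1, e1⟩ := exists_second_primitive hT c1 z1 d1
  exact ⟨c, γ₀, γ₁, hT, hp, hu, k0, k1, e0, e1⟩

theorem IsLaw.exists_solution {c : ℝ} {γ₀ γ₁ A A' A'' : ℝ → ℝ} (ha₀ : 0 < a₀)
    (hd : IsData T c p₀ u₀ g₀ g₁ γ₀ γ₁) (h : IsLaw a₀ a₁ a₂ a₃ A A' A'') :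
    ∃ v, IsVelocity T A' (affine γ₀ γ₁) v ∧
      ∃ p u : ℝ → Sob 1 0 1, IsClassicalSolution T p₀ u₀ g₀ g₁ A p u ∧
      ∀ t ∈ Icc 0 T, (∀ x ∈ Icc (0 : ℝ) 1,
        rep (u t) x = prim v x t + prim (prim (affine γ₀ γ₁)) x t) ∧
        rep (p t) 0 - rep (p t) 1 = drop A' (affine γ₀ γ₁) v t := by
  have ha₁ : 0 < a₁ := ha₀.trans_le ((h.lower 0).trans (h.upper 0))
  obtain ⟨v, hv⟩ := exists_isVelocity (T := T) (a₁ := a₁) (a₂ := a₂) hd.pos.le ha₁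
    ((abs_nonneg _).trans (h.abs_le 0))
    (fun x => by rw [abs_of_nonneg (ha₀.le.trans (h.lower x))]; exact h.upper x) h.abs_fst_sub_le
    (continuous_affine hd.continuous₀ hd.continuous₁)
  exact ⟨v, hv, hv.exists_isClassicalSolution hd.pos h.hasDerivAt h.continuous_fst h.zero hd.p₀_eq
    hd.u₀_eq hd.continuous₀ hd.continuous₁ hd.g₀_eq hd.g₁_eq⟩

theorem exists_areFluxBounds (ha₀ : 0 < a₀) {c : ℝ} {γ₀ γ₁ : ℝ → ℝ}
    (hd : IsData T c p₀ u₀ g₀ g₁ γ₀ γ₁) :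
    ∃ ul uh : ℝ, AreFluxBounds a₀ a₁ a₂ a₃ T p₀ u₀ g₀ g₁ ul uh := by
  have hγ := continuous_affine hd.continuous₀ hd.continuous₁
  obtain ⟨Γ, hΓ'⟩ := exists_bound_of_continuous hγ T
  obtain ⟨C, hC'⟩ := exists_bound_of_continuous (continuous_prim (continuous_prim hγ)) T
  have hT := hd.pos.le
  have hΓ : ∀ x ∈ Icc (0 : ℝ) 1, ∀ t ∈ Icc 0 T, |affine γ₀ γ₁ x t| ≤ Γ := fun x hx t ht => by
    have := hΓ' x t (abs_le.2 ⟨by linarith [ht.1], ht.2⟩)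
    rwa [fold_of_mem hx] at this
  have hC : ∀ x ∈ Icc (0 : ℝ) 1, ∀ t ∈ Icc 0 T, |prim (prim (affine γ₀ γ₁)) x t| ≤ C :=
    fun x hx t ht => by
      have := hC' x t (abs_le.2 ⟨by linarith [ht.1], ht.2⟩)
      rwa [fold_of_mem hx] at this
  have hC0 : 0 ≤ C := (abs_nonneg _).trans (hC 0 (by simp) 0 (by simp [hT]))
  set V := velocityBound T a₁ Γ with hV
  set M : ℝ := |V| * T + C + 1 with hM
  have hM0 : 0 < M := by positivity
  refine ⟨-M, M, by linarith, fun A p u hA hs => ?_⟩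
  obtain ⟨A', A'', hl⟩ := hA.exists_isLaw
  have ha₁ : 0 < a₁ := ha₀.trans_le ((hl.lower 0).trans (hl.upper 0))
  obtain ⟨v, hv, p', u', hs', hrep⟩ := hl.exists_solution ha₀ hd
  have hu := (hs.eqOn (hl.monotone ha₀.le) hs').2
  have hb := abs_velocity_le hT ha₁ hΓ hv.continuous (fun x _ t _ => by
    refine (abs_add_le _ _).trans (add_le_add le_rfl ?_)
    rw [abs_mul]
    refine mul_le_mul ?_ (abs_add_le _ _) (abs_nonneg _) ha₁.le
    rw [abs_of_nonneg (ha₀.le.trans (hl.lower _))]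
    exact hl.upper _) hv.eq
  intro t ht x hx
  rw [hu ht, (hrep t ht).1 x hx]
  refine abs_le.1 ((abs_add_le _ _).trans ?_)
  have h1 := abs_prim_le (k := v) (x := x) (C := |V|) ht.1 fun τ hτ =>
    (hb x hx τ ⟨hτ.1, hτ.2.trans ht.2⟩).trans (le_abs_self _)
  have h2 := mul_le_mul_of_nonneg_left ht.2 (abs_nonneg V)
  have h3 := hC x hx t ht
  linarith

/-- For damping laws with parameter `y`, there is exactly one state, and the forward operator gives
its pressure drop. -/
theorem forward_spec (ha₀ : 0 < a₀) {c ul uh : ℝ} {γ₀ γ₁ : ℝ → ℝ}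
    (hd : IsData T c p₀ u₀ g₀ g₁ γ₀ γ₁) (hb : AreFluxBounds a₀ a₁ a₂ a₃ T p₀ u₀ g₀ g₁ ul uh)
    {y : Param} (hy : y ∈ lawSet a₀ a₁ a₂ a₃) :
    ∃ v, IsVelocity T (law' y) (affine γ₀ γ₁) v ∧
      (∀ x ∈ Icc (0 : ℝ) 1, ∀ t ∈ Icc 0 T,
        prim v x t + prim (prim (affine γ₀ γ₁)) x t ∈ Icc ul uh) ∧
      (∃ p u : ℝ → Sob 1 0 1, IsState T p₀ u₀ g₀ g₁ (lawSob hb.1 y) p u ∧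
        ∀ p' u' : ℝ → Sob 1 0 1, IsState T p₀ u₀ g₀ g₁ (lawSob hb.1 y) p' u' →
          EqOn p' p (Icc 0 T) ∧ EqOn u' u (Icc 0 T)) ∧
      IsPressureDrop T p₀ u₀ g₀ g₁ (lawSob hb.1 y) (F T p₀ u₀ g₀ g₁ (lawSob hb.1 y)) ∧
      F T p₀ u₀ g₀ g₁ (lawSob hb.1 y) =ᵐ[volume.restrict (Ioo 0 T)]
        drop (law' y) (affine γ₀ γ₁) v := by
  have hl : IsLaw a₀ a₁ a₂ a₃ (law y) (law' y) y.2 := hy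
  have hγ := continuous_affine hd.continuous₀ hd.continuous₁
  obtain ⟨v, hv, p, u, hs, hrep⟩ := hl.exists_solution ha₀ hd
  have hr := hb.2 _ p u hl.a1 hs
  have heq : EqOn (rep (lawSob hb.1 y)) (law y) (Icc ul uh) :=
    rep_eqOn hb.1 hl.continuous.continuousOn (fn_lawSob_ae_eq hb.1 y)
  have hst : IsState T p₀ u₀ g₀ g₁ (lawSob hb.1 y) p u := ⟨hr, hs.congr_law hr heq.symm⟩
  have huniq : ∀ p' u' : ℝ → Sob 1 0 1, IsState T p₀ u₀ g₀ g₁ (lawSob hb.1 y) p' u' →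
      EqOn p' p (Icc 0 T) ∧ EqOn u' u (Icc 0 T) := fun p' u' h' =>
    (h'.2.congr_law h'.1 heq).eqOn (hl.monotone ha₀.le) hs
  have hdrop : ∃ h, IsPressureDrop T p₀ u₀ g₀ g₁ (lawSob hb.1 y) h := by
    refine ⟨ofCont hd.pos.le (restr 0 T (drop (law' y) (affine γ₀ γ₁) v)
      (continuous_drop hl.continuous_fst hγ hv.continuous).continuousOn), p, u, hst, ?_⟩
    filter_upwards [ofCont_restr_ae_eq hd.pos.le
      (continuous_drop hl.continuous_fst hγ hv.continuous).continuousOn,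
      ae_restrict_mem measurableSet_Ioo] with t h1 ht
    rw [h1, (hrep t (Ioo_subset_Icc_self ht)).2]
  have hF : IsPressureDrop T p₀ u₀ g₀ g₁ (lawSob hb.1 y) (F T p₀ u₀ g₀ g₁ (lawSob hb.1 y)) :=
    Classical.epsilon_spec hdrop
  refine ⟨v, hv, fun x hx t ht => ?_, ⟨p, u, hst, huniq⟩, hF, ?_⟩
  · rw [← (hrep t ht).1 x hx]
    exact hr t ht x hx
  · obtain ⟨p', u', h', e⟩ := hF
    filter_upwards [e, ae_restrict_mem measurableSet_Ioo] with t h1 ht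
    have ht' := Ioo_subset_Icc_self ht
    rw [h1, (huniq p' u' h').1 ht', (hrep t ht').2]

theorem continuousOn_forward (ha₀ : 0 < a₀) {c ul uh : ℝ} {γ₀ γ₁ : ℝ → ℝ}
    (hd : IsData T c p₀ u₀ g₀ g₁ γ₀ γ₁) (hb : AreFluxBounds a₀ a₁ a₂ a₃ T p₀ u₀ g₀ g₁ ul uh) :
    ContinuousOn (fun y => F T p₀ u₀ g₀ g₁ (lawSob hb.1 y)) (lawSet a₀ a₁ a₂ a₃) := by
  have hT := hd.pos.le
  have hγ := continuous_affine hd.continuous₀ hd.continuous₁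
  let R : C(Param, C(Icc ul uh, ℝ)) := familyIcc ul uh law continuous_law
  set κ : ℝ := measureUnivNNReal (volume.restrict (Ioo 0 T)) ^ (2 : ENNReal).toReal⁻¹ *
    (2 * (T + T * Real.exp (2 * a₁ * T))) with hκ
  have key : ∀ y ∈ lawSet a₀ a₁ a₂ a₃, ∀ z ∈ lawSet a₀ a₁ a₂ a₃,
      ‖F T p₀ u₀ g₀ g₁ (lawSob hb.1 y) - F T p₀ u₀ g₀ g₁ (lawSob hb.1 z)‖ ≤
        κ * dist (R y) (R z) := by
    intro y hy z hz
    obtain ⟨v, hv, hrv, -, -, ev⟩ := forward_spec ha₀ hd hb hy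
    obtain ⟨w, hw, -, -, -, ew⟩ := forward_spec ha₀ hd hb hz
    rw [hκ, mul_assoc]
    refine norm_sub_le_of_continuous (by positivity) ev ew ?_
    refine abs_drop_sub_le hT dist_nonneg ha₀ hy hz hγ hv hw fun x hx t ht => ?_
    exact ContinuousMap.dist_apply_le_dist (f := R y) (g := R z) ⟨_, hrv x hx t ht⟩
  intro y hy
  rw [ContinuousWithinAt, tendsto_iff_norm_sub_tendsto_zero]
  have hlim : Filter.Tendsto (fun z => κ * dist (R z) (R y)) (nhdsWithin y (lawSet a₀ a₁ a₂ a₃))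
      (nhds 0) := by
    have hc : Continuous fun z => κ * dist (R z) (R y) :=
      continuous_const.mul (R.continuous.dist continuous_const)
    have := (hc.tendsto y).mono_left (nhdsWithin_le_nhds (s := lawSet a₀ a₁ a₂ a₃))
    simpa using this
  refine squeeze_zero' (.of_forall fun _ => norm_nonneg _) ?_ hlim
  filter_upwards [self_mem_nhdsWithin] with z hz
  exact key z hz y hy

theorem lawSet_nonempty (ha₁ : a₀ ≤ a₁) (ha₂ : 0 ≤ a₂) (ha₃ : 0 ≤ a₃) :
    (lawSet a₀ a₁ a₂ a₃).Nonempty := by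
  have h : IsLaw a₀ a₁ a₂ a₃ (fun x => a₀ * x) (fun _ => a₀) (fun _ => 0) :=
    ⟨mul_zero _, fun x => by simpa using (hasDerivAt_id x).const_mul a₀,
      fun x => hasDerivAt_const x a₀, fun _ => le_rfl, fun _ => ha₁, by simpa using ha₂,
      fun x y => by simpa using mul_nonneg ha₃ (abs_nonneg (x - y))⟩
  obtain ⟨y, hy, _⟩ := h.exists_param
  exact ⟨y, hy⟩

end

end DampedWave

theorem mainTheorem6 (a₀ a₁ a₂ a₃ : ℝ) (ha₀ : 0 < a₀) (ha₁ : a₀ ≤ a₁) (ha₂ : 0 < a₂)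
    (ha₃ : 0 < a₃) (T : ℝ) (p₀ u₀ g₀ g₁ : ℝ → ℝ)
    (hA2 : DampedWave.A2 p₀ u₀) (hA3 : DampedWave.A3 T g₀ g₁) :
    (∃ ul uh : ℝ, DampedWave.AreFluxBounds a₀ a₁ a₂ a₃ T p₀ u₀ g₀ g₁ ul uh) ∧
    ∀ ul uh : ℝ, DampedWave.AreFluxBounds a₀ a₁ a₂ a₃ T p₀ u₀ g₀ g₁ ul uh →
      (∀ a ∈ DampedWave.domF a₀ a₁ a₂ a₃ ul uh,
        (∃ p u : ℝ → DampedWave.Sob 1 0 1, DampedWave.IsState T p₀ u₀ g₀ g₁ a p u ∧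
          ∀ p' u' : ℝ → DampedWave.Sob 1 0 1, DampedWave.IsState T p₀ u₀ g₀ g₁ a p' u' →
            Set.EqOn p' p (Set.Icc 0 T) ∧ Set.EqOn u' u (Set.Icc 0 T)) ∧
        DampedWave.IsPressureDrop T p₀ u₀ g₀ g₁ a (DampedWave.F T p₀ u₀ g₀ g₁ a)) ∧
      ∀ (α : ℝ), 0 < α → ∀ (hδ : DampedWave.L2 0 T) (aStar : DampedWave.Sob 2 ul uh),
        ∃ a ∈ DampedWave.domF a₀ a₁ a₂ a₃ ul uh,
          IsMinOn (DampedWave.tikhonov T p₀ u₀ g₀ g₁ α hδ aStar)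
            (DampedWave.domF a₀ a₁ a₂ a₃ ul uh) a := by
  obtain ⟨c, γ₀, γ₁, hd⟩ := DampedWave.exists_isData hA2 hA3
  refine ⟨DampedWave.exists_areFluxBounds ha₀ hd, fun ul uh hb => ⟨fun a ha => ?_, ?_⟩⟩
  · rw [DampedWave.domF_eq_image hb.1] at ha
    obtain ⟨y, hy, rfl⟩ := ha
    obtain ⟨-, -, -, h1, h2, -⟩ := DampedWave.forward_spec ha₀ hd hb hy
    exact ⟨h1, h2⟩
  · intro α _ hδ aStar
    have hcont : ContinuousOn (fun y => DampedWave.tikhonov T p₀ u₀ g₀ g₁ α hδ aStar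
        (DampedWave.lawSob hb.1 y)) (DampedWave.lawSet a₀ a₁ a₂ a₃) :=
      (((DampedWave.continuousOn_forward ha₀ hd hb).sub continuousOn_const).norm.pow 2).add
        (continuousOn_const.mul ((((DampedWave.continuous_lawSob hb.1).sub
          continuous_const).norm.pow 2).continuousOn))
    obtain ⟨y, hy, hmin⟩ := (DampedWave.isCompact_lawSet a₀ a₁ a₂ a₃).exists_isMinOn
      (DampedWave.lawSet_nonempty ha₁ ha₂.le ha₃.le) hcont
    rw [DampedWave.domF_eq_image hb.1]
    refine ⟨_, Set.mem_image_of_mem _ hy, ?_⟩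
    rintro _ ⟨z, hz, rfl⟩
    exact hmin hz
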